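/- Let $k$ be a field and $s\ge 1$. For a word $w$ over the alphabet $\{1,\dots,s\}$ let $|w|$ be its length. For a commutative $k$-algebra $R$ let $\mathfrak M^s(R)$ be the set of power series $f=\sum_{|w|\ge1}f_wz_w$ without constant term in $s$ non-commuting variables, with the boxed convolution $$(f\boxtimes g)_w=\sum_{\pi\in \mathrm{NC}(n)}\ \prod_{V\in\pi}f_{w|V}\ \prod_{V\in K(\pi)}g_{w|V}\qquad(n=|w|\ge1),$$ where $\mathrm{NC}(n)$ is the set of non-crossing partitions of $\{1,\dots,n\}$, $w|V$ is the restriction of the word $w$ to the positions in the block $V$, and $K(\pi)$ is the Kreweras complement of $\pi$, i.e. the maximal non-crossing partition of $\{\bar1,\dots,\bar n\}$ such that $\pi\cup K(\pi)$ is a non-crossing partition of $\{1<\bar1<2<\bar2<\dots<n<\bar n\}$. Put $$\mathfrak G^s(R)=\{f: f_{(i)}\in R^\times\ (1\le i\le s)\},\quad (\mathfrak G^s)_1(R)=\{f\in\mathfrak G^s(R): f_w=0\text{ for }|w|\ge2\},\quad \mathfrak G^s_+(R)=\{f: f_{(i)}=1\ (1\le i\le s)\}.$$ **Theorem.** With the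 product $\boxtimes$, the functors $\mathfrak G^s$, $(\mathfrak G^s)_1$ and $\mathfrak G^s_+$ from commutative $k$-algebras to sets are group-valued functors, and they are affine group schemes. More precisely: 1. $\mathfrak G^s$ is represented by a Hopf algebra structure on $A=k[X_1^{\pm1},\dots,X_s^{\pm1},X_w:|w|\ge2]$, with $X_w$ (and $X_i=X_{(i)}$) the coordinate function $f\mapsto f_w$; that is, $\varphi\mapsto\sum_w\varphi(X_w)z_w$ is a natural bijection $\mathrm{Hom}_{k\text{-alg}}(A,R)\to\mathfrak G^s(R)$ which takes the convolution product to $\boxtimes$. Let $C_j$ be the $k$-linear span of the monomials of weight at most $j$, where $X_i^{\pm1}$ has weight $0$ and $X_w$ has weight $|w|-1$. Then $C_0\subsetneq C_1\subsetneq\cdots$ is an exhaustive filtration of the Hopf algebra $A$: $1\in C_0$, $C_mC_n\subseteq C_{m+n}$, $\Delta(C_n)\subseteq\sum_{j=0}^nC_j\otimes C_{n-j}$, $S(C_n)\subseteq C_n$; and $C_0$ is the $k$-linear span of the group-like elements of $A$. But $A$ is not connected: it is not co-connected as a Hopf algebra, and it is not a local ring. 2. $(\mathfrak G^s)_1$ is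 represented, in the same sense, by a Hopf algebra structure on $k[X_1^{\pm1},\dots,X_s^{\pm1}]$. All Laurent monomials in it are group-like, so that it is spanned over $k$ by its group-like elements. 3. $\mathfrak G^s_+$ is represented, in the same sense (with $\bar X_{(i)}=1$), by a Hopf algebra structure on $k[\bar X_w:|w|\ge2]$. This Hopf algebra is co-connected. It is co-commutative if and only if $s=1$. Here a Hopf algebra $A$ over $k$ is called co-connected if there are subspaces $A_0\subseteq A_1\subseteq\cdots$ of $A$ with $A_0=k$, $\bigcup_jA_j=A$ and $\Delta(A_n)\subseteq\sum_{j=0}^nA_j\otimes A_{n-j}$ for all $n\ge0$. -/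

import Mathlib

open CategoryTheory TensorProduct

universe u

noncomputable section

namespace BoxedConvolution

/-! ### Non-crossing partitions and the Kreweras complement -/

/-- A relation on a linearly ordered set is non-crossing if `p₁ < q₁ < p₂ < q₂` with `p₁ ∼ p₂` and
`q₁ ∼ q₂` forces `p₂ ∼ q₁`. -/
def NonCrossingRel {α : Type*} [LinearOrder α] (r : α → α → Prop) : Prop :=
  ∀ p₁ q₁ p₂ q₂ : α, p₁ < q₁ → q₁ < p₂ → p₂ < q₂ → r p₁ p₂ → r q₁ q₂ → r p₂ q₁

/-- Partitions of the ordered set `{1 < ⋯ < n}`, modelled on `Fin n`. They are ordered by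
refinement: `σ ≤ π` if every block of `σ` is contained in a block of `π`. -/
abbrev Part (n : ℕ) : Type := Finpartition (Finset.univ : Finset (Fin n))

/-- `i` and `j` lie in the same block of `π`. -/
def SameBlock {n : ℕ} (π : Part n) (i j : Fin n) : Prop := i ∈ π.part j

/-- Non-crossing partitions of `{1 < ⋯ < n}`. -/
def IsNonCrossing {n : ℕ} (π : Part n) : Prop := NonCrossingRel (SameBlock π)

/-- The equivalence relation of the partition `π ∪ σ` of the ordered set
`{1 < 1̄ < 2 < 2̄ < ⋯ < n < n̄}`, with `π` a partition of the unbarred elements `i = (i, false)` and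
`σ` one of the barred elements `ī = (i, true)`. -/
def UnionRel {n : ℕ} (π σ : Part n) (x y : Fin n ×ₗ Bool) : Prop :=
  ((ofLex x).2 = false ∧ (ofLex y).2 = false ∧ SameBlock π (ofLex x).1 (ofLex y).1) ∨
  ((ofLex x).2 = true ∧ (ofLex y).2 = true ∧ SameBlock σ (ofLex x).1 (ofLex y).1)

/-- `ī` and `j̄` (with `i ≤ j`, say) are related if no block of `π` meets both the interval
`(i, j]` and its complement. -/
def krewerasSetoid {n : ℕ} (π : Part n) : Setoid (Fin n) where
  r i j := ∀ a b, SameBlock π a b → ((a ≤ i ↔ a ≤ j) ↔ (b ≤ i ↔ b ≤ j))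
  iseqv :=
    { refl := fun i a b _ => by simp
      symm := fun {i j} h a b hab => by have := h a b hab; tauto
      trans := fun {i j l} h h' a b hab => by
        have h1 := h a b hab
        have h2 := h' a b hab
        tauto }

open Classical in
/-- The Kreweras complement `K(π)`. By `kreweras_isGreatest` it is the maximal non-crossing
partition `σ` of `{1̄, …, n̄}` such that `π ∪ σ` is non-crossing. -/
def kreweras {n : ℕ} (π : Part n) : Part n := Finpartition.ofSetoid (krewerasSetoid π)

theorem sameBlock_symm {n : ℕ} {π : Part n} {i j : Fin n} (h : SameBlock π i j) :
    SameBlock π j i := by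
  unfold SameBlock at *
  rw [Finpartition.mem_part_iff_exists] at *
  obtain ⟨p, hp, h1, h2⟩ := h
  exact ⟨p, hp, h2, h1⟩

theorem sameBlock_kreweras {n : ℕ} {π : Part n} {i j : Fin n} :
    SameBlock (kreweras π) i j ↔
      ∀ a b, SameBlock π a b → ((a ≤ i ↔ a ≤ j) ↔ (b ≤ i ↔ b ≤ j)) := by
  classical
  have key : SameBlock (kreweras π) j i ↔ krewerasSetoid π j i := by
    unfold SameBlock kreweras
    rw [Finpartition.mem_part_ofSetoid_iff_rel]
    exact ⟨fun h => (krewerasSetoid π).symm h, fun h => (krewerasSetoid π).symm h⟩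
  constructor
  · intro h
    exact (krewerasSetoid π).symm (key.1 (sameBlock_symm h))
  · intro h
    exact sameBlock_symm (key.2 ((krewerasSetoid π).symm h))

theorem part_le_of_sameBlock {n : ℕ} {σ τ : Part n}
    (h : ∀ i j, SameBlock σ i j → SameBlock τ i j) : σ ≤ τ := by
  intro b hb
  obtain ⟨i, hi⟩ := σ.nonempty_of_mem_parts hb
  refine ⟨τ.part i, τ.part_mem.2 (Finset.mem_univ i), fun j hj => ?_⟩
  apply h
  unfold SameBlock
  rw [Finpartition.mem_part_iff_exists]
  exact ⟨b, hb, hj, hi⟩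

theorem lex_lt_iff {n : ℕ} (i j : Fin n) (x y : Bool) :
    (toLex (i, x) : Fin n ×ₗ Bool) < toLex (j, y) ↔ i < j ∨ i = j ∧ x = false ∧ y = true := by
  rw [Prod.Lex.toLex_lt_toLex]
  cases x <;> cases y <;> simp

theorem kreweras_isGreatest {n : ℕ} (π : Part n) (hπ : IsNonCrossing π) :
    IsGreatest {σ : Part n | IsNonCrossing σ ∧ NonCrossingRel (UnionRel π σ)} (kreweras π) := by
  have hK : IsNonCrossing (kreweras π) := by
    intro a b c d hab hbc hcd hac hbd
    rw [sameBlock_kreweras] at *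
    intro x y hxy
    have h1 := hac x y hxy
    have h2 := hbd x y hxy
    have m : ∀ z : Fin n, (z ≤ a → z ≤ b) ∧ (z ≤ b → z ≤ c) ∧ (z ≤ c → z ≤ d) := fun z =>
      ⟨fun h => h.trans hab.le, fun h => h.trans hbc.le, fun h => h.trans hcd.le⟩
    have mx := m x
    have my := m y
    clear m hac hbd hxy hab hbc hcd
    grind
  refine ⟨⟨hK, ?_⟩, ?_⟩
  · rintro ⟨a, x⟩ ⟨b, y⟩ ⟨c, z⟩ ⟨d, t⟩ hab hbc hcd hac hbd
    change (toLex (a, x) : Fin n ×ₗ Bool) < toLex (b, y) at hab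
    change (toLex (b, y) : Fin n ×ₗ Bool) < toLex (c, z) at hbc
    change (toLex (c, z) : Fin n ×ₗ Bool) < toLex (d, t) at hcd
    rw [lex_lt_iff] at hab hbc hcd
    rcases hac with ⟨hx, hz, hac⟩ | ⟨hx, hz, hac⟩ <;>
    rcases hbd with ⟨hy, ht, hbd⟩ | ⟨hy, ht, hbd⟩ <;>
    change x = _ at hx <;> change z = _ at hz <;> change y = _ at hy <;> change t = _ at ht <;>
    change SameBlock _ a c at hac <;> change SameBlock _ b d at hbd <;>
    subst hx hz hy ht <;> simp at hab hbc hcd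
    · exact Or.inl ⟨rfl, rfl, hπ a b c d hab hbc hcd hac hbd⟩
    · have := (sameBlock_kreweras.1 hbd) a c hac
      exfalso
      have h1 : a ≤ b := by omega
      have h2 : a ≤ d := by omega
      have h3 : ¬ c ≤ b := by omega
      have h4 : c ≤ d := by omega
      simp_all
    · have := (sameBlock_kreweras.1 hac) b d hbd
      exfalso
      have h1 : ¬ b ≤ a := by omega
      have h2 : b ≤ c := by omega
      have h3 : ¬ d ≤ a := by omega
      have h4 : ¬ d ≤ c := by omega
      simp_all
    · exact Or.inr ⟨rfl, rfl, hK a b c d hab hbc hcd hac hbd⟩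
  · rintro σ ⟨-, hσ⟩
    -- a block of `π` separated by a pair of `σ` would produce a crossing
    have key : ∀ i j a b : Fin n, i < j → SameBlock σ i j → SameBlock π a b →
        (i < a ∧ a ≤ j) → (i < b ∧ b ≤ j) := by
      intro i j a b hij hσij hab ha
      by_contra hb
      rcases lt_or_ge i b with hib | hib
      · have hjb : j < b := by
          by_contra h
          exact hb ⟨hib, not_lt.1 h⟩
        have := hσ (toLex (i, true)) (toLex (a, false)) (toLex (j, true)) (toLex (b, false))
          (by rw [lex_lt_iff]; exact Or.inl ha.1)
          (by rw [lex_lt_iff]; rcases ha.2.lt_or_eq with h | h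
              · exact Or.inl h
              · exact Or.inr ⟨h, by simp⟩)
          (by rw [lex_lt_iff]; exact Or.inl hjb)
          (Or.inr ⟨rfl, rfl, hσij⟩) (Or.inl ⟨rfl, rfl, hab⟩)
        rcases this with ⟨h, -, -⟩ | ⟨-, h, -⟩ <;> simp at h
      · have := hσ (toLex (b, false)) (toLex (i, true)) (toLex (a, false)) (toLex (j, true))
          (by rw [lex_lt_iff]; rcases hib.lt_or_eq with h | h
              · exact Or.inl h
              · exact Or.inr ⟨h, by simp⟩)
          (by rw [lex_lt_iff]; exact Or.inl ha.1)
          (by rw [lex_lt_iff]; rcases ha.2.lt_or_eq with h | h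
              · exact Or.inl h
              · exact Or.inr ⟨h, by simp⟩)
          (Or.inl ⟨rfl, rfl, sameBlock_symm hab⟩) (Or.inr ⟨rfl, rfl, hσij⟩)
        rcases this with ⟨-, h, -⟩ | ⟨h, -, -⟩ <;> simp at h
    apply part_le_of_sameBlock
    intro i j hij
    rw [sameBlock_kreweras]
    intro a b hab
    rcases lt_trichotomy i j with h | h | h
    · have h1 := key i j a b h hij hab
      have h2 := key i j b a h hij (sameBlock_symm hab)
      by_cases hai : a ≤ i <;> by_cases haj : a ≤ j <;> by_cases hbi : b ≤ i <;>
        by_cases hbj : b ≤ j <;> omega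
    · subst h; simp
    · have h1 := key j i a b h (sameBlock_symm hij) hab
      have h2 := key j i b a h (sameBlock_symm hij) (sameBlock_symm hab)
      by_cases hai : a ≤ i <;> by_cases haj : a ≤ j <;> by_cases hbi : b ≤ i <;>
        by_cases hbj : b ≤ j <;> omega

/-! ### Boxed convolution of non-commutative power series -/

/-- The set `R₊⟨⟨z₁, …, z_s⟩⟩` of power series `∑_w f_w z_w` without constant term in `s`
non-commuting variables; words over `{1, …, s}` are lists in `Fin s`. -/
structure PSeries (s : ℕ) (R : Type u) [CommRing R] : Type u where
  /-- The coefficient `X_w(f)`. -/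
  coeff : List (Fin s) → R
  coeff_nil : coeff [] = 0

/-- The restriction `w|V` of a word to a set of positions. -/
def restrict {s : ℕ} (w : List (Fin s)) (V : Finset (Fin w.length)) : List (Fin s) :=
  V.sort.map w.get

/-- `X_{w,π}(f) = ∏_{V ∈ π} X_{w|V}(f)`. -/
def PSeries.partCoeff {s : ℕ} {R : Type u} [CommRing R] (f : PSeries s R)
    (w : List (Fin s)) (π : Part w.length) : R :=
  ∏ V ∈ π.parts, f.coeff (restrict w V)

open Classical in
/-- The boxed convolution:
`X_w(f ⊠ g) = ∑_{π ∈ NC(|w|)} X_{w,π}(f) X_{w,K(π)}(g)` for every non-empty word `w`. -/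
def boxConv {s : ℕ} {R : Type u} [CommRing R] (f g : PSeries s R) : PSeries s R :=
  ⟨fun w => if w = [] then 0 else
      ∑ π : Part w.length with IsNonCrossing π, f.partCoeff w π * g.partCoeff w (kreweras π),
    if_pos rfl⟩

/-- Push-forward of coefficients along an algebra homomorphism. -/
def PSeries.map {k : Type u} [CommRing k] {s : ℕ} {R R' : Type u} [CommRing R] [CommRing R']
    [Algebra k R] [Algebra k R'] (φ : R →ₐ[k] R') (f : PSeries s R) : PSeries s R' :=
  ⟨fun w => φ (f.coeff w), by rw [f.coeff_nil, map_zero]⟩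

/-! ### The functors -/

/-- The `k`-functor `R ↦ 𝔐ˢ(R) = R₊⟨⟨z₁, …, z_s⟩⟩`. -/
def seriesFunctor (k : Type u) [CommRing k] (s : ℕ) : CommAlgCat.{u} k ⥤ Type u where
  obj R := PSeries s R
  map φ := ↾(PSeries.map φ.hom)

/-- `𝔊ˢ`: the coefficients of the words of length one are units. -/
def G (k : Type u) [CommRing k] (s : ℕ) : Subfunctor (seriesFunctor k s) where
  obj R := {f : PSeries s R | ∀ i, IsUnit (f.coeff [i])}
  map φ _ hf i := (hf i).map φ.hom

/-- `(𝔊ˢ)₁`: the truncation of `𝔊ˢ` to words of length one. -/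
def G₁ (k : Type u) [CommRing k] (s : ℕ) : Subfunctor (seriesFunctor k s) where
  obj R := {f : PSeries s R | (∀ i, IsUnit (f.coeff [i])) ∧ ∀ w, 1 < w.length → f.coeff w = 0}
  map φ f hf := ⟨fun i => (hf.1 i).map φ.hom, fun w hw => by
    change φ.hom (PSeries.coeff f w) = 0
    rw [hf.2 w hw, map_zero]⟩

/-- `𝔊ˢ₊`: the coefficients of the words of length one are `1`. -/
def GPlus (k : Type u) [CommRing k] (s : ℕ) : Subfunctor (seriesFunctor k s) where
  obj R := {f : PSeries s R | ∀ i, f.coeff [i] = 1}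
  map φ f hf i := by
    change φ.hom (PSeries.coeff f [i]) = 1
    rw [hf i, map_one]

/-- A structure of `k`-group functor on a subfunctor of `𝔐ˢ` whose multiplication is the boxed
convolution. -/
structure BoxGroup {k : Type u} [CommRing k] {s : ℕ} (F : Subfunctor (seriesFunctor k s)) where
  group : ∀ R, Group (F.toFunctor.obj R)
  mul_eq : ∀ R (f g : F.toFunctor.obj R), (f * g).1 = boxConv (R := R) f.1 g.1
  map_mul : ∀ {R R' : CommAlgCat.{u} k} (φ : R ⟶ R') (f g : F.toFunctor.obj R),
    F.toFunctor.map φ (f * g) = F.toFunctor.map φ f * F.toFunctor.map φ g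

/-- The group-valued functor belonging to a structure of `k`-group functor. -/
def BoxGroup.toGrp {k : Type u} [CommRing k] {s : ℕ} {F : Subfunctor (seriesFunctor k s)}
    (𝒢 : BoxGroup F) : CommAlgCat.{u} k ⥤ GrpCat.{u} where
  obj R := letI := 𝒢.group R; GrpCat.of (F.toFunctor.obj R)
  map {R R'} φ :=
    letI := 𝒢.group R
    letI := 𝒢.group R'
    GrpCat.ofHom (MonoidHom.mk' (fun f => F.toFunctor.map φ f) (𝒢.map_mul φ))
  map_id R := by
    let := 𝒢.group R
    apply ConcreteCategory.hom_ext
    intro f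
    exact congrArg (fun h : F.toFunctor.obj R ⟶ F.toFunctor.obj R => h f) (F.toFunctor.map_id R)
  map_comp {R R' R''} φ ψ := by
    let := 𝒢.group R
    let := 𝒢.group R''
    apply ConcreteCategory.hom_ext
    intro f
    exact congrArg (fun h : F.toFunctor.obj R ⟶ F.toFunctor.obj R'' => h f)
      (F.toFunctor.map_comp φ ψ)

/-! ### Hopf algebras -/

section Hopf

variable (k A : Type u) [CommRing k] [CommRing A] [Algebra k A]

/-- A Hopf algebra structure on a given commutative `k`-algebra. -/
structure HopfStr where
  comul : A →ₐ[k] A ⊗[k] A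
  counit : A →ₐ[k] k
  antipode : A →ₗ[k] A
  coassoc : (Algebra.TensorProduct.assoc k k k A A A).toAlgHom.comp
      ((Algebra.TensorProduct.map comul (.id k A)).comp comul)
      = (Algebra.TensorProduct.map (.id k A) comul).comp comul
  rTensor_counit : (Algebra.TensorProduct.map counit (.id k A)).comp comul
      = (Algebra.TensorProduct.lid k A).symm
  lTensor_counit : (Algebra.TensorProduct.map (.id k A) counit).comp comul
      = (Algebra.TensorProduct.rid k k A).symm
  mul_antipode_rTensor : LinearMap.mul' k A ∘ₗ antipode.rTensor A ∘ₗ comul.toLinearMap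
      = Algebra.linearMap k A ∘ₗ counit.toLinearMap
  mul_antipode_lTensor : LinearMap.mul' k A ∘ₗ antipode.lTensor A ∘ₗ comul.toLinearMap
      = Algebra.linearMap k A ∘ₗ counit.toLinearMap

variable {k A}

/-- The Hopf algebra in the sense of Mathlib. -/
abbrev HopfStr.toHopfAlgebra (H : HopfStr k A) : HopfAlgebra k A :=
  { Bialgebra.ofAlgHom H.comul H.counit H.coassoc H.rTensor_counit H.lTensor_counit with
    antipode := H.antipode
    mul_antipode_rTensor_comul := H.mul_antipode_rTensor
    mul_antipode_lTensor_comul := H.mul_antipode_lTensor }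

/-- Group-like elements: `Δ(a) = a ⊗ a` and `ε(a) = 1`. -/
def HopfStr.IsGroupLike (H : HopfStr k A) (a : A) : Prop :=
  letI := H.toHopfAlgebra
  IsGroupLikeElem k a

/-- Co-commutativity. -/
def HopfStr.IsCocomm (H : HopfStr k A) : Prop :=
  letI := H.toHopfAlgebra
  Coalgebra.IsCocomm k A

/-- The convolution product `μ ∘ (φ ⊗ ψ) ∘ Δ` on `Spec_k(A)(R) = Hom(A, R)`. -/
def HopfStr.conv (H : HopfStr k A) {R : Type u} [CommRing R] [Algebra k R]
    (φ ψ : A →ₐ[k] R) : A →ₐ[k] R :=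
  (Algebra.TensorProduct.productMap φ ψ).comp H.comul

/-- `Δ(F_n) ⊆ ∑_{j ≤ n} F_j ⊗ F_{n-j}` for all `n`. -/
def HopfStr.ComulFiltered (H : HopfStr k A) (F : ℕ → Submodule k A) : Prop :=
  ∀ n, ∀ a ∈ F n, H.comul a ∈
    ⨆ j ∈ Finset.range (n + 1), Submodule.map₂ (TensorProduct.mk k A A) (F j) (F (n - j))

/-- A filtration of the Hopf algebra, indexed by `ℕ`: an exhaustive ascending chain of subspaces
compatible with unit, product, co-product and antipode. -/
structure HopfStr.IsFiltration (H : HopfStr k A) (F : ℕ → Submodule k A) : Prop where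
  mono : Monotone F
  exhaustive : ∀ a, ∃ n, a ∈ F n
  one_mem : 1 ∈ F 0
  mul_mem : ∀ m n, ∀ a ∈ F m, ∀ b ∈ F n, a * b ∈ F (m + n)
  comul_mem : H.ComulFiltered F
  antipode_mem : ∀ n, ∀ a ∈ F n, H.antipode a ∈ F n

/-- Co-connected Hopf algebras: there is an exhaustive ascending filtration by subspaces `A_n`
with `A_0 = k` and `Δ(A_n) ⊆ ∑_j A_j ⊗ A_{n-j}`. -/
def HopfStr.IsCoconnected (H : HopfStr k A) : Prop :=
  ∃ F : ℕ → Submodule k A, Monotone F ∧ F 0 = LinearMap.range (Algebra.linearMap k A) ∧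
    (∀ a, ∃ n, a ∈ F n) ∧ H.ComulFiltered F

/-- The Hopf algebra `H` represents the `k`-group functor `𝒢`, in such a way that `x w ∈ A` is the
`w`-th coordinate function: there is a natural bijection `Hom(A, R) ≃ F(R)`, sending `φ` to the
series with coefficients `φ(x w)`, which turns the convolution product into the product
of `𝒢`. -/
def Represents {s : ℕ} (H : HopfStr k A) {F : Subfunctor (seriesFunctor k s)} (𝒢 : BoxGroup F)
    (x : List (Fin s) → A) : Prop :=
  ∃ ρ : F.toFunctor.CorepresentableBy (CommAlgCat.of k A),
    ∀ (R : Type u) [CommRing R] [Algebra k R] (φ ψ : A →ₐ[k] R),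
      (∀ w, PSeries.coeff (ρ.homEquiv (CommAlgCat.ofHom φ)).1 w = φ (x w)) ∧
      letI := 𝒢.group (CommAlgCat.of k R)
      ρ.homEquiv (CommAlgCat.ofHom (H.conv φ ψ)) =
        ρ.homEquiv (CommAlgCat.ofHom φ) * ρ.homEquiv (CommAlgCat.ofHom ψ)

end Hopf

/-! ### The coordinate algebras -/

/-- Words of length at least two. -/
abbrev LongWord (s : ℕ) : Type := {w : List (Fin s) // 2 ≤ w.length}

/-- Laurent polynomials `k[X₁^{±1}, …, X_s^{±1}]`, with basis the monomials `X^e`, `e ∈ ℤˢ`. -/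
abbrev Laurent (k : Type u) [CommRing k] (s : ℕ) : Type u := AddMonoidAlgebra k (Fin s → ℤ)

/-- The Laurent monomial `X^e`. -/
def laurentMonomial (k : Type u) [CommRing k] {s : ℕ} (e : Fin s → ℤ) : Laurent k s :=
  AddMonoidAlgebra.single e 1

/-- `k[X₁^{±1}, …, X_s^{±1}, X_w : |w| ≥ 2]`. -/
abbrev CoordG (k : Type u) [CommRing k] (s : ℕ) : Type u := MvPolynomial (LongWord s) (Laurent k s)

/-- `k[X̄_w : |w| ≥ 2]`. -/
abbrev CoordGPlus (k : Type u) [CommRing k] (s : ℕ) : Type u := MvPolynomial (LongWord s) k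

/-- The coordinate functions `X_w` on `(𝔊ˢ)₁`. -/
def coordG₁ (k : Type u) [CommRing k] (s : ℕ) : List (Fin s) → Laurent k s
  | [i] => laurentMonomial k (Pi.single i 1)
  | _ => 0

/-- The coordinate functions `X_w` on `𝔊ˢ`. -/
def coordG (k : Type u) [CommRing k] (s : ℕ) : List (Fin s) → CoordG k s
  | [] => 0
  | [i] => MvPolynomial.C (laurentMonomial k (Pi.single i 1))
  | i :: j :: w => MvPolynomial.X ⟨i :: j :: w, by simp⟩

/-- The coordinate functions `X̄_w` on `𝔊ˢ₊`. -/
def coordGPlus (k : Type u) [CommRing k] (s : ℕ) : List (Fin s) → CoordGPlus k s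
  | [] => 0
  | [_] => 1
  | i :: j :: w => MvPolynomial.X ⟨i :: j :: w, by simp⟩

/-- The span `C_j` of the monomials of weight at most `j`, where `X_i^{±1}` has weight `0` and
`X_w` has weight `|w| - 1`. -/
def weightFiltration (k : Type u) [CommRing k] (s : ℕ) (j : ℕ) : Submodule k (CoordG k s) :=
  Submodule.span k {p | ∃ (e : Fin s → ℤ) (m : LongWord s →₀ ℕ),
    m.sum (fun w c => c * (w.1.length - 1)) ≤ j ∧
    p = MvPolynomial.monomial m (laurentMonomial k e)}

end BoxedConvolution

end

open BoxedConvolution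

/-! The theorem rests on three facts about non-crossing partitions of `n` points. (1) The Kreweras
complement K is an order-reversing bijection: a non-crossing partition is recovered from its
complement (`sameBlockIn_iff_kreweras`), and the inverse of K is K conjugated by the mirror image
(`kreweras_revPart_kreweras`). (2) For π ≤ σ let K_σ(π) be the union of the complements of π taken
inside the blocks of σ. Then K_{K(π)}(K_σ(π)) = K(σ) (`relKreweras_kreweras`), so σ ↦ K_σ(π) is a
bijection from the non-crossing partitions above π to those below K(π) (`relKreweras_bijOn`). (3)
|π| + |K(π)| ≥ n + 1, where |·| counts blocks (`card_parts_add_card_parts_kreweras`).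

By (2), both bracketings of f ⊠ g ⊠ h have as coefficient at w the sum of f_π g_{K_σ(π)} h_{K(σ)}
over non-crossing π ≤ σ (`boxConv_assoc`). In (f ⊠ g)_w the partition into singletons contributes ∏
f_{(w_i)} · g_w, and all other terms involve g at shorter words only. Hence a series with invertible
linear coefficients has a right inverse, found by recursion on the length of w, and associativity
makes it two-sided.

The series U with coefficients X_w is universal for each functor. By Yoneda, Δ, ε and S are the
homomorphisms classifying (U ⊗ 1) ⊠ (1 ⊗ U), the unit series and the inverse of U; the Hopf axioms
are the group axioms for series, read through universality (`IsUniversal.hopfStr`).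

Since Δ(X_w) = ∑ X_{w,π} ⊗ X_{w,K(π)}, fact (3) bounds the weight of each term by (n - |π|) + (n -
|K(π)|) ≤ n - 1, so the weight filtration is one of Hopf algebras. Over a field, group-like elements
lie in the bottom step of any exhaustive coalgebra filtration (`HopfStr.IsGroupLike.mem_zero`). This
identifies C_0 as the span of the group-likes, and excludes co-connectedness of 𝔊ˢ, because X_1 is
group-like and not a scalar. For 𝔊ˢ₊ the bottom step is k. Finally, π ↦ mirror of K(π) exchanges the
two factors when s = 1, while for s ≥ 2 the series ∑ z_i + z_a z_b and ∑ z_i + z_b z_a do not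
commute at the word aba. -/

noncomputable section

namespace BoxedConvolution

/-! ### Partitions of subsets of `Fin n` as relations -/

section Partitions

variable {n : ℕ} {V : Finset (Fin n)}

/-- `i` and `j` lie in a common block of the partition `P` of `V`. -/
def SameBlockIn (P : Finpartition V) (i j : Fin n) : Prop := ∃ U ∈ P.parts, i ∈ U ∧ j ∈ U

theorem sameBlock_iff {π : Part n} {i j : Fin n} : SameBlock π i j ↔ SameBlockIn π i j :=
  Finpartition.mem_part_iff_exists _

theorem SameBlockIn.symm {P : Finpartition V} {i j : Fin n} (h : SameBlockIn P i j) :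
    SameBlockIn P j i := by
  obtain ⟨U, hU, hi, hj⟩ := h
  exact ⟨U, hU, hj, hi⟩

theorem sameBlockIn_comm {P : Finpartition V} {i j : Fin n} :
    SameBlockIn P i j ↔ SameBlockIn P j i := ⟨.symm, .symm⟩

theorem SameBlockIn.trans {P : Finpartition V} {i j l : Fin n} (h : SameBlockIn P i j)
    (h' : SameBlockIn P j l) : SameBlockIn P i l := by
  obtain ⟨U, hU, hi, hj⟩ := h
  obtain ⟨U', hU', hj', hl⟩ := h'
  obtain rfl := P.eq_of_mem_parts hU hU' hj hj'
  exact ⟨U, hU, hi, hl⟩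

theorem SameBlockIn.mem_left {P : Finpartition V} {i j : Fin n} (h : SameBlockIn P i j) :
    i ∈ V := by
  obtain ⟨U, hU, hi, -⟩ := h
  exact P.le hU hi

theorem SameBlockIn.mem_right {P : Finpartition V} {i j : Fin n} (h : SameBlockIn P i j) :
    j ∈ V := h.symm.mem_left

theorem sameBlockIn_self {P : Finpartition V} {i : Fin n} : SameBlockIn P i i ↔ i ∈ V := by
  refine ⟨fun h => h.mem_left, fun h => ?_⟩
  obtain ⟨U, hU, hi⟩ := P.exists_mem h
  exact ⟨U, hU, hi, hi⟩

theorem sameBlockIn_refl (π : Part n) (i : Fin n) : SameBlockIn π i i :=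
  sameBlockIn_self.2 (Finset.mem_univ i)

theorem sameBlockIn_iff_mem {P : Finpartition V} {U : Finset (Fin n)} (hU : U ∈ P.parts)
    {i j : Fin n} (hi : i ∈ U) : SameBlockIn P i j ↔ j ∈ U := by
  constructor
  · rintro ⟨U', hU', hi', hj⟩
    rwa [P.eq_of_mem_parts hU hU' hi hi']
  · exact fun hj => ⟨U, hU, hi, hj⟩

theorem le_iff_sameBlockIn {P Q : Finpartition V} :
    P ≤ Q ↔ ∀ i j, SameBlockIn P i j → SameBlockIn Q i j := by
  constructor
  · rintro h i j ⟨U, hU, hi, hj⟩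
    obtain ⟨U', hU', hle⟩ := h hU
    exact ⟨U', hU', hle hi, hle hj⟩
  · intro h U hU
    obtain ⟨i, hi⟩ := P.nonempty_of_mem_parts hU
    obtain ⟨U', hU', hi', -⟩ := h i i ⟨U, hU, hi, hi⟩
    refine ⟨U', hU', fun j hj => ?_⟩
    exact (sameBlockIn_iff_mem hU' hi').1 (h i j ⟨U, hU, hi, hj⟩)

theorem finpartition_ext {P Q : Finpartition V}
    (h : ∀ i j, SameBlockIn P i j ↔ SameBlockIn Q i j) : P = Q :=
  le_antisymm (le_iff_sameBlockIn.2 fun i j => (h i j).1)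
    (le_iff_sameBlockIn.2 fun i j => (h i j).2)

open Classical in
theorem sameBlockIn_ofSetSetoid {r : Setoid (Fin n)} {i j : Fin n} :
    SameBlockIn (Finpartition.ofSetSetoid r V) i j ↔ i ∈ V ∧ j ∈ V ∧ r i j := by
  have := Finpartition.mem_part_ofSetSetoid_iff_rel (s := r) V (a := i) (b := j)
  rw [← this, Finpartition.mem_part_iff_exists]
  exact ⟨fun ⟨U, hU, hi, hj⟩ => ⟨U, hU, hj, hi⟩, fun ⟨U, hU, hi, hj⟩ => ⟨U, hU, hj, hi⟩⟩

theorem sameBlockIn_bind {P : Finpartition V} {Q : ∀ U ∈ P.parts, Finpartition U}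
    {i j : Fin n} :
    SameBlockIn (P.bind Q) i j ↔ ∃ U, ∃ hU : U ∈ P.parts, SameBlockIn (Q U hU) i j := by
  constructor
  · rintro ⟨W, hW, hi, hj⟩
    obtain ⟨U, hU, h⟩ := Finpartition.mem_bind.1 hW
    exact ⟨U, hU, W, h, hi, hj⟩
  · rintro ⟨U, hU, W, h, hi, hj⟩
    exact ⟨W, Finpartition.mem_bind.2 ⟨U, hU, h⟩, hi, hj⟩

theorem sameBlockIn_bind_of_mem {P : Finpartition V} {Q : ∀ U ∈ P.parts, Finpartition U}
    {U : Finset (Fin n)} (hU : U ∈ P.parts) {i j : Fin n} (hi : i ∈ U) :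
    SameBlockIn (P.bind Q) i j ↔ SameBlockIn (Q U hU) i j := by
  rw [sameBlockIn_bind]
  constructor
  · rintro ⟨U', hU', h⟩
    obtain rfl := P.eq_of_mem_parts hU hU' hi h.mem_left
    exact h
  · exact fun h => ⟨U, hU, h⟩

/-- Restriction of a partition to a subset. -/
def restrictPart (P : Finpartition V) {U : Finset (Fin n)} (hU : U ⊆ V) : Finpartition U :=
  P.restrict hU

theorem sameBlockIn_restrictPart {P : Finpartition V} {U : Finset (Fin n)} {hU : U ⊆ V}
    {i j : Fin n} : SameBlockIn (restrictPart P hU) i j ↔ SameBlockIn P i j ∧ i ∈ U ∧ j ∈ U := by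
  unfold restrictPart SameBlockIn Finpartition.restrict
  simp only [Finset.mem_erase, Finset.mem_image]
  constructor
  · rintro ⟨W, ⟨-, W', hW', rfl⟩, hi, hj⟩
    simp only [Finset.inf_eq_inter, Finset.mem_inter] at hi hj
    exact ⟨⟨W', hW', hi.1, hj.1⟩, hi.2, hj.2⟩
  · rintro ⟨⟨W, hW, hi, hj⟩, hiU, hjU⟩
    have hiWU : i ∈ W ⊓ U := Finset.mem_inter.2 ⟨hi, hiU⟩
    exact ⟨W ⊓ U, ⟨fun h => Finset.notMem_empty i (by rw [h] at hiWU; exact hiWU), W, hW, rfl⟩, hiWU,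
      Finset.mem_inter.2 ⟨hj, hjU⟩⟩

theorem sameBlockIn_bot {i j : Fin n} :
    SameBlockIn (⊥ : Finpartition V) i j ↔ i ∈ V ∧ i = j := by
  constructor
  · rintro ⟨U, hU, hi, hj⟩
    obtain ⟨a, ha, rfl⟩ := Finpartition.mem_bot_iff.1 hU
    simp only [Finset.mem_singleton] at hi hj
    subst hi hj
    exact ⟨ha, rfl⟩
  · rintro ⟨hi, rfl⟩
    exact sameBlockIn_self.2 hi

/-! ### Kreweras complements inside a subset, and relative to a partition -/

/-- Non-crossing partitions of a subset. -/
def IsNonCrossingIn (P : Finpartition V) : Prop := NonCrossingRel (SameBlockIn P)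

theorem isNonCrossing_iff {π : Part n} : IsNonCrossing π ↔ IsNonCrossingIn π := by
  unfold IsNonCrossing IsNonCrossingIn NonCrossingRel
  simp only [sameBlock_iff]

/-- The relation defining the Kreweras complement of a partition of a subset. -/
def krewerasInSetoid (P : Finpartition V) : Setoid (Fin n) where
  r i j := ∀ a b, SameBlockIn P a b → ((a ≤ i ↔ a ≤ j) ↔ (b ≤ i ↔ b ≤ j))
  iseqv :=
    { refl := fun i a b _ => by simp
      symm := fun {i j} h a b hab => by have := h a b hab; tauto
      trans := fun {i j l} h h' a b hab => by
        have h1 := h a b hab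
        have h2 := h' a b hab
        tauto }

open Classical in
/-- The Kreweras complement of a partition of a subset `V` of `Fin n`. -/
def krewerasIn (P : Finpartition V) : Finpartition V :=
  Finpartition.ofSetSetoid (krewerasInSetoid P) V

theorem sameBlockIn_krewerasIn {P : Finpartition V} {i j : Fin n} :
    SameBlockIn (krewerasIn P) i j ↔ i ∈ V ∧ j ∈ V ∧
      ∀ a b, SameBlockIn P a b → ((a ≤ i ↔ a ≤ j) ↔ (b ≤ i ↔ b ≤ j)) :=
  sameBlockIn_ofSetSetoid

theorem sameBlockIn_kreweras {π : Part n} {i j : Fin n} :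
    SameBlockIn (kreweras π) i j ↔
      ∀ a b, SameBlockIn π a b → ((a ≤ i ↔ a ≤ j) ↔ (b ≤ i ↔ b ≤ j)) := by
  rw [← sameBlock_iff, sameBlock_kreweras]
  simp only [sameBlock_iff]

/-- The Kreweras complement of `π` relative to `σ`: the union of the Kreweras complements of the
restrictions of `π` to the blocks of `σ`. -/
def relKreweras (σ π : Part n) : Part n :=
  σ.bind fun U _ => krewerasIn (restrictPart π (Finset.subset_univ U))

theorem sameBlockIn_relKreweras {σ π : Part n} {i j : Fin n} :
    SameBlockIn (relKreweras σ π) i j ↔ SameBlockIn σ i j ∧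
      ∀ a b, SameBlockIn σ i a → SameBlockIn σ i b → SameBlockIn π a b →
        ((a ≤ i ↔ a ≤ j) ↔ (b ≤ i ↔ b ≤ j)) := by
  obtain ⟨U, hU, hi⟩ := σ.exists_mem (Finset.mem_univ i)
  unfold relKreweras
  rw [sameBlockIn_bind_of_mem hU hi, sameBlockIn_krewerasIn]
  simp only [sameBlockIn_restrictPart, sameBlockIn_iff_mem hU hi]
  constructor
  · exact fun ⟨_, hj, h⟩ => ⟨hj, fun a b ha hb hab => h a b ⟨hab, ha, hb⟩⟩
  · exact fun ⟨hj, h⟩ => ⟨hi, hj, fun a b ⟨hab, ha, hb⟩ => h a b ha hb hab⟩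

/-- For a < b < c < d the interval (b, c] is the intersection of (a, c] and (b, d]. A block that is
cut by neither of these is not cut by their intersection. -/
theorem isNonCrossingIn_krewerasIn (P : Finpartition V) : IsNonCrossingIn (krewerasIn P) := by
  intro a b c d hab hbc hcd hac hbd
  rw [sameBlockIn_krewerasIn] at *
  refine ⟨hac.2.1, hbd.1, ?_⟩
  intro x y hxy
  have h1 := hac.2.2 x y hxy
  have h2 := hbd.2.2 x y hxy
  have m : ∀ z : Fin n, (z ≤ a → z ≤ b) ∧ (z ≤ b → z ≤ c) ∧ (z ≤ c → z ≤ d) := fun z =>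
    ⟨fun h => h.trans hab.le, fun h => h.trans hbc.le, fun h => h.trans hcd.le⟩
  have mx := m x
  have my := m y
  clear m hac hbd hxy hab hbc hcd
  grind

theorem isNonCrossing_kreweras (π : Part n) : IsNonCrossing (kreweras π) := by
  rw [isNonCrossing_iff]
  convert isNonCrossingIn_krewerasIn π
  apply finpartition_ext
  intro i j
  rw [sameBlockIn_kreweras, sameBlockIn_krewerasIn]
  simp

/-- A union of non-crossing partitions of the blocks of a non-crossing partition is
non-crossing. -/
theorem isNonCrossing_bind {σ : Part n} (hσ : IsNonCrossing σ)
    {Q : ∀ U ∈ σ.parts, Finpartition U} (hQ : ∀ U hU, IsNonCrossingIn (Q U hU)) :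
    IsNonCrossing (σ.bind Q) := by
  rw [isNonCrossing_iff] at *
  intro a b c d hab hbc hcd hac hbd
  obtain ⟨U, hU, hac'⟩ := sameBlockIn_bind.1 hac
  obtain ⟨W, hW, hbd'⟩ := sameBlockIn_bind.1 hbd
  have hcb := hσ a b c d hab hbc hcd ⟨U, hU, hac'.mem_left, hac'.mem_right⟩
    ⟨W, hW, hbd'.mem_left, hbd'.mem_right⟩
  have hb : b ∈ U := (sameBlockIn_iff_mem hU hac'.mem_right).1 hcb
  obtain rfl := σ.eq_of_mem_parts hU hW hb hbd'.mem_left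
  exact sameBlockIn_bind.2 ⟨U, hU, hQ U hU a b c d hab hbc hcd hac' hbd'⟩

theorem isNonCrossing_relKreweras {σ : Part n} (hσ : IsNonCrossing σ) (π : Part n) :
    IsNonCrossing (relKreweras σ π) :=
  isNonCrossing_bind hσ fun _ _ => isNonCrossingIn_krewerasIn _

theorem kreweras_anti {π σ : Part n} (h : π ≤ σ) : kreweras σ ≤ kreweras π := by
  rw [le_iff_sameBlockIn] at *
  intro i j hij
  rw [sameBlockIn_kreweras] at *
  exact fun a b hab => hij a b (h a b hab)

/-- One implication is enough because `SameBlockIn` is symmetric. This is the form in which "the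
interval (i, j] cuts no block" is checked below. -/
theorem sameBlockIn_kreweras_of_lt {π : Part n} {i j : Fin n} (hij : i ≤ j)
    (h : ∀ a b, SameBlockIn π a b → i < a → a ≤ j → i < b ∧ b ≤ j) :
    SameBlockIn (kreweras π) i j := by
  rw [sameBlockIn_kreweras]
  intro a b hab
  have h1 := h a b hab
  have h2 := h b a hab.symm
  by_cases hai : a ≤ i <;> by_cases haj : a ≤ j <;> by_cases hbi : b ≤ i <;>
    by_cases hbj : b ≤ j <;> omega

/-- The partition can be recovered from its Kreweras complement. -/
theorem sameBlockIn_iff_kreweras {π : Part n} (hπ : IsNonCrossing π) {i j : Fin n} :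
    SameBlockIn π i j ↔
      ∀ a b, SameBlockIn (kreweras π) a b → ((a < i ↔ a < j) ↔ (b < i ↔ b < j)) := by
  rw [isNonCrossing_iff] at hπ
  constructor
  · intro hij a b hab
    have := sameBlockIn_kreweras.1 hab i j hij
    simp only [← not_le]
    tauto
  · intro h
    by_contra hij
    wlog hlt : i < j generalizing i j
    · refine this (i := j) (j := i) (fun a b hab => ?_) (fun h => hij h.symm) ?_
      · have := h a b hab
        tauto
      · rcases lt_trichotomy i j with h | rfl | h
        · exact absurd h hlt
        · exact absurd (sameBlockIn_refl π i) hij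
        · exact h
    classical
    -- the last element `v` before `j` of the block of `i`
    obtain ⟨v, hv, hvmax⟩ := Finset.exists_maximal (s := {x | SameBlockIn π i x ∧ x < j})
      ⟨i, by simp [sameBlockIn_refl, hlt]⟩
    simp only [Finset.mem_filter, Finset.mem_univ, true_and] at hv hvmax
    have hiv : i ≤ v := by
      by_contra hc
      have := hvmax ⟨sameBlockIn_refl π i, hlt⟩ (not_le.1 hc).le
      exact hc this
    -- K(π) joins v to the position p just before the cyclic successor of v in its block. The
    -- interval [i, j) contains v but not p, which contradicts `h`.
    by_cases hex : ∃ x, SameBlockIn π i x ∧ j < x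
    · obtain ⟨v', hv', hvmin⟩ := Finset.exists_minimal (s := {x | SameBlockIn π i x ∧ j < x})
        (by obtain ⟨x, hx⟩ := hex; exact ⟨x, by simpa using hx⟩)
      simp only [Finset.mem_filter, Finset.mem_univ, true_and] at hv' hvmin
      have hv'n := v'.2
      have hjv' : j.1 < v'.1 := hv'.2
      obtain ⟨p, hp⟩ : ∃ p : Fin n, p.1 + 1 = v'.1 := ⟨⟨v'.1 - 1, by omega⟩, by simp; omega⟩
      have hK : SameBlockIn (kreweras π) v p := by
        apply sameBlockIn_kreweras_of_lt
        · have := hv.2; omega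
        · intro a b hab hva hap
          have hgap : ∀ x, v < x → x < v' → ¬ SameBlockIn π i x := by
            intro x hvx hxv hix
            rcases lt_trichotomy x j with h1 | rfl | h1
            · exact absurd (hvmax ⟨hix, h1⟩ hvx.le) (not_le.2 hvx)
            · exact hij hix
            · exact absurd (hvmin ⟨hix, h1⟩ hxv.le) (not_le.2 hxv)
          have hva' : a < v' := by omega
          have hia := hgap a hva hva'
          have hvv' : SameBlockIn π v v' := hv.1.symm.trans hv'.1
          by_contra hb
          rcases lt_trichotomy b v with hbv | rfl | hbv
          · have := hπ b v a v' hbv hva hva' hab.symm hvv'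
            exact hia (hv.1.trans this.symm)
          · exact hia (hv.1.trans hab.symm)
          · have hvb : v' ≤ b := by
              by_contra hc
              exact hb ⟨hbv, by omega⟩
            rcases hvb.lt_or_eq with hlt' | rfl
            · have := hπ v a v' b hva hva' hlt' hvv' hab
              exact hia (hv'.1.trans this)
            · exact hia (hv'.1.trans hab.symm)
      have := h v p hK
      have h1 := hv.2
      have : ¬ v < i := by omega
      have : ¬ p < i := by omega
      have : ¬ p < j := by omega
      simp_all
    · -- `v` is the last element of the block
      have hlast : ∀ x, SameBlockIn π i x → x ≤ v := by
        intro x hx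
        by_contra hc
        rcases lt_trichotomy x j with h1 | rfl | h1
        · exact hc (hvmax ⟨hx, h1⟩ (not_le.1 hc).le)
        · exact hij hx
        · exact hex ⟨x, hx, h1⟩
      obtain ⟨m, hm, hmmin⟩ := Finset.exists_minimal (s := {x | SameBlockIn π i x})
        ⟨i, by simp [sameBlockIn_refl]⟩
      simp only [Finset.mem_filter, Finset.mem_univ, true_and] at hm hmmin
      have hmle : ∀ x, SameBlockIn π i x → m ≤ x := by
        intro x hx
        by_contra hc
        exact hc (hmmin hx (not_le.1 hc).le)
      -- The convex hull [m, v] of the block of i is a union of blocks, as π is non-crossing.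
      have hcl : ∀ a b, SameBlockIn π a b → m ≤ a → a ≤ v → m ≤ b ∧ b ≤ v := by
        intro a b hab hma hav
        by_cases hia : SameBlockIn π i a
        · exact ⟨hmle b (hia.trans hab), hlast b (hia.trans hab)⟩
        · have hma' : m < a := hma.lt_of_ne (by rintro rfl; exact hia hm)
          have hav' : a < v := hav.lt_of_ne (by rintro rfl; exact hia hv.1)
          have hmv : SameBlockIn π m v := hm.symm.trans hv.1
          constructor
          · by_contra hc
            exact hia (hm.trans (hπ b m a v (not_le.1 hc) hma' hav' hab.symm hmv).symm)
          · by_contra hc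
            exact hia (hv.1.trans (hπ m a v b hma' hav' (not_le.1 hc) hmv hab))
      have hvj := hv.2
      have hmi := hmle i (sameBlockIn_refl π i)
      -- The cyclic successor of v is now the least element m, so p is m - 1, or the last position
      -- when m is the first one.
      rcases Nat.eq_zero_or_pos m.1 with hm0 | hm0
      · have hn := j.2
        obtain ⟨p, hp⟩ : ∃ p : Fin n, p.1 + 1 = n := ⟨⟨n - 1, by omega⟩, by simp; omega⟩
        have hK : SameBlockIn (kreweras π) v p := by
          apply sameBlockIn_kreweras_of_lt
          · omega
          · intro a b hab hva hap
            refine ⟨?_, by omega⟩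
            by_contra hc
            have := hcl b a hab.symm (by omega) (by omega)
            omega
        have := h v p hK
        have : ¬ v < i := by omega
        have : ¬ p < i := by omega
        have : ¬ p < j := by omega
        simp_all
      · obtain ⟨p, hp⟩ : ∃ p : Fin n, p.1 + 1 = m.1 := ⟨⟨m.1 - 1, by omega⟩, by simp; omega⟩
        have hK : SameBlockIn (kreweras π) p v := by
          apply sameBlockIn_kreweras_of_lt
          · omega
          · intro a b hab hpa hav
            have := hcl a b hab (by omega) hav
            exact ⟨by omega, this.2⟩
        have := h p v hK
        have : ¬ v < i := by omega
        have : p < i := by omega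
        have : p < j := by omega
        simp_all

theorem le_of_kreweras_le {π σ : Part n} (hσ : IsNonCrossing σ)
    (h : kreweras σ ≤ kreweras π) : π ≤ σ := by
  rw [le_iff_sameBlockIn] at *
  intro i j hij
  rw [sameBlockIn_iff_kreweras hσ]
  intro a b hab
  have := sameBlockIn_kreweras.1 (h a b hab) i j hij
  simp only [← not_le]
  tauto

theorem kreweras_injOn : Set.InjOn kreweras {π : Part n | IsNonCrossing π} :=
  fun _ hπ _ hσ h => le_antisymm (le_of_kreweras_le hσ h.ge) (le_of_kreweras_le hπ h.le)

/-- Let K_σ(π) join i and j. Blocks of π inside the σ-block of i are not cut by (i, j] by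
definition; any other block of π lies in a σ-block which, σ being non-crossing, cannot be cut by (i,
j] since i and j share a block of σ. -/
theorem relKreweras_le_kreweras {σ π : Part n} (hσ : IsNonCrossing σ) (h : π ≤ σ) :
    relKreweras σ π ≤ kreweras π := by
  rw [isNonCrossing_iff] at hσ
  rw [le_iff_sameBlockIn] at *
  intro i j hij
  wlog hle : i ≤ j generalizing i j
  · exact (this j i hij.symm (not_le.1 hle).le).symm
  obtain ⟨hσij, hK⟩ := sameBlockIn_relKreweras.1 hij
  apply sameBlockIn_kreweras_of_lt hle
  intro a b hab hia haj
  have hσab := h a b hab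
  by_cases hσia : SameBlockIn σ i a
  · have := hK a b hσia (hσia.trans hσab) hab
    have h1 : ¬ a ≤ i := not_le.2 hia
    simp only [h1, haj] at this
    by_cases hbi : b ≤ i
    · have : b ≤ j := hbi.trans hle
      simp_all
    · simp_all
  · have haj' : a < j := haj.lt_of_ne (by rintro rfl; exact hσia hσij)
    by_contra hc
    rcases lt_trichotomy b i with hb | rfl | hb
    · exact hσia (hσ b i a j hb hia haj' hσab.symm hσij).symm
    · exact hσia hσab.symm
    · have hjb : j < b := by
        by_contra hc'
        exact hc ⟨hb, not_lt.1 hc'⟩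
      exact hσia (hσij.trans (hσ i a j b hia haj' hjb hσij hσab))

/-- `K_{K(π)}(K_σ(π)) = K(σ)`. -/
theorem relKreweras_kreweras {σ π : Part n} (hσ : IsNonCrossing σ) (h : π ≤ σ) :
    relKreweras (kreweras π) (relKreweras σ π) = kreweras σ := by
  have hρ := le_iff_sameBlockIn.1 (relKreweras_le_kreweras hσ h)
  rw [isNonCrossing_iff] at hσ
  have hle := le_iff_sameBlockIn.1 h
  apply finpartition_ext
  intro i j
  constructor
  · intro hij
    wlog hlt : i ≤ j generalizing i j
    · exact (this j i hij.symm (not_le.1 hlt).le).symm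
    obtain ⟨hπ, hK⟩ := sameBlockIn_relKreweras.1 hij
    classical
    by_contra hcon
    -- If K(σ) does not join i and j, then (i, j] cuts some block of σ. The aim is a pair a, b in
    -- that block, joined by K_σ(π) and also cut by (i, j], with a in the K(π)-block of i. The
    -- element a is the last one of the block in (i, j].
    have hx : ∃ x y, SameBlockIn σ x y ∧ (i < x ∧ x ≤ j) ∧ ¬ (i < y ∧ y ≤ j) := by
      by_contra hx
      push Not at hx
      exact hcon (sameBlockIn_kreweras_of_lt hlt fun a b hab h1 h2 => hx a b hab ⟨h1, h2⟩)
    obtain ⟨x, y, hxy, hxin, hyout⟩ := hx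
    obtain ⟨a, ha, hamax⟩ := Finset.exists_maximal
      (s := {z | SameBlockIn σ x z ∧ i < z ∧ z ≤ j})
      ⟨x, by simp [sameBlockIn_refl, hxin]⟩
    simp only [Finset.mem_filter, Finset.mem_univ, true_and] at ha hamax
    have hamax' : ∀ z, SameBlockIn σ x z → i < z → z ≤ j → z ≤ a := by
      intro z h1 h2 h3
      by_contra hc
      exact hc (hamax ⟨h1, h2, h3⟩ (not_le.1 hc).le)
    have hπc := sameBlockIn_kreweras.1 hπ
    -- a `π`-block inside the `σ`-block of `x` is not cut by `(i, j]`
    have hcut : ∀ c d, SameBlockIn π c d → i < c → c ≤ j → i < d ∧ d ≤ j := by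
      intro c d hcd hic hcj
      have := hπc c d hcd
      have h1 : ¬ c ≤ i := not_le.2 hic
      by_cases hdi : d ≤ i
      · have : d ≤ j := hdi.trans hlt
        simp_all
      · simp_all
    -- A block of π cut by (a, j] would lie in a block of σ other than that of x, with elements on
    -- both sides of a inside (i, j]; it would cross the pair a, y.
    have haj : SameBlockIn (kreweras π) a j := by
      apply sameBlockIn_kreweras_of_lt ha.2.2
      intro c d hcd hac hcj
      have hd := hcut c d hcd (ha.2.1.trans hac) hcj
      refine ⟨?_, hd.2⟩
      by_contra hda
      have hcd' := hle c d hcd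
      have hcx : ¬ SameBlockIn σ x c := fun hxc =>
        absurd (hamax' c hxc (ha.2.1.trans hac) hcj) (not_le.2 hac)
      have hda' : d < a := lt_of_le_of_ne (not_lt.1 hda) (by
        rintro rfl
        exact hcx (ha.1.trans hcd'.symm))
      have hay : SameBlockIn σ a y := ha.1.symm.trans hxy
      by_cases hiy : i < y
      · have hyj : j < y := by
          by_contra hc'
          exact hyout ⟨hiy, not_lt.1 hc'⟩
        have := hσ d a c y hda' hac (hcj.trans_lt hyj) hcd'.symm hay
        exact hcx (ha.1.trans this.symm)
      · have hyd : y < d := lt_of_le_of_lt (not_lt.1 hiy) hd.1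
        have := hσ y d a c hyd hda' hac hay.symm hcd'.symm
        exact hcx (ha.1.trans (this.trans hcd'.symm))
    -- the cyclic predecessor of the part of the block lying in `(i, j]`
    have hb : ∃ b, SameBlockIn (relKreweras σ π) a b ∧ ¬ (i < b ∧ b ≤ j) := by
      by_cases hex : ∃ z, SameBlockIn σ x z ∧ z ≤ i
      · obtain ⟨b, hb, hbmax⟩ := Finset.exists_maximal
          (s := {z | SameBlockIn σ x z ∧ z ≤ i})
          (by obtain ⟨z, hz⟩ := hex; exact ⟨z, by simpa using hz⟩)
        simp only [Finset.mem_filter, Finset.mem_univ, true_and] at hb hbmax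
        have hbmax' : ∀ z, SameBlockIn σ x z → z ≤ i → z ≤ b := by
          intro z h1 h2
          by_contra hc
          exact hc (hbmax ⟨h1, h2⟩ (not_le.1 hc).le)
        have hchar : ∀ c, SameBlockIn σ a c → ((c ≤ a ↔ c ≤ b) ↔ ¬ (i < c ∧ c ≤ j)) := by
          intro c hac
          have hxc := ha.1.trans hac
          have h1 := hamax' c hxc
          have h2 := hbmax' c hxc
          have h3 := ha.2
          have h4 := hb.2
          omega
        refine ⟨b, sameBlockIn_relKreweras.2 ⟨ha.1.symm.trans hb.1, ?_⟩, by
          have := hb.2; omega⟩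
        intro c d hac had hcd
        rw [hchar c hac, hchar d had]
        exact not_congr ⟨fun h => hcut c d hcd h.1 h.2, fun h => hcut d c hcd.symm h.1 h.2⟩
      · push Not at hex
        obtain ⟨b, hb, hbmax⟩ := Finset.exists_maximal
          (s := {z | SameBlockIn σ x z})
          ⟨x, by simp [sameBlockIn_refl]⟩
        simp only [Finset.mem_filter, Finset.mem_univ, true_and] at hb hbmax
        have hbmax' : ∀ z, SameBlockIn σ x z → z ≤ b := by
          intro z h1
          by_contra hc
          exact hc (hbmax h1 (not_le.1 hc).le)
        have hjb : j < b := by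
          have h1 := hex y hxy
          have h2 := hbmax' y hxy
          by_contra hc
          exact hyout ⟨h1, h2.trans (not_lt.1 hc)⟩
        have hchar : ∀ c, SameBlockIn σ a c → ((c ≤ a ↔ c ≤ b) ↔ (i < c ∧ c ≤ j)) := by
          intro c hac
          have hxc := ha.1.trans hac
          have h1 := hamax' c hxc
          have h2 := hbmax' c hxc
          have h3 := ha.2
          have h4 := hex c hxc
          omega
        -- No element of the block precedes (i, j], so b is its last element. Here (a, b] is the
        -- complement of (i, j] within the block, which serves equally well.
        refine ⟨b, sameBlockIn_relKreweras.2 ⟨ha.1.symm.trans hb, ?_⟩, by omega⟩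
        intro c d hac had hcd
        rw [hchar c hac, hchar d had]
        exact ⟨fun h => hcut c d hcd h.1 h.2, fun h => hcut d c hcd.symm h.1 h.2⟩
    obtain ⟨b, hab, hbout⟩ := hb
    -- Both a and b lie in the K(π)-block of i, and `hK` forbids (i, j] to separate them.
    have hia : SameBlockIn (kreweras π) i a := hπ.trans haj.symm
    have := hK a b hia (hia.trans (hρ a b hab)) hab
    have h1 := ha.2
    by_cases hbi : b ≤ i <;> by_cases hbj : b ≤ j <;> simp_all <;> omega
  · intro hij
    have hKσ := sameBlockIn_kreweras.1 hij
    refine sameBlockIn_relKreweras.2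
      ⟨le_iff_sameBlockIn.1 (kreweras_anti h) i j hij, fun a b _ _ hab => ?_⟩
    exact hKσ a b (sameBlockIn_relKreweras.1 hab).1

/-- The sizes of a partition and of its Kreweras complement. -/
theorem card_parts_add_card_parts_kreweras (hn : n ≠ 0) (π : Part n) :
    n + 1 ≤ π.parts.card + (kreweras π).parts.card := by
  classical
  obtain ⟨m, rfl⟩ := Nat.exists_eq_succ_of_ne_zero hn
  -- the minimal elements of the blocks
  let M : Finset (Fin (m + 1)) := {x | ∀ y, SameBlockIn π x y → x ≤ y}
  let X : Finset (Fin (m + 1)) := {x | ∀ y, SameBlockIn (kreweras π) x y → y ≤ x}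
  have hM : M.card ≤ π.parts.card := by
    refine Finset.card_le_card_of_injOn π.part (fun x _ => π.part_mem.2 (Finset.mem_univ x)) ?_
    intro x hx y hy hxy
    have hxy' : SameBlockIn π x y := by
      rw [← sameBlock_iff]
      change x ∈ π.part y
      rw [← hxy]
      exact π.mem_part_self.2 (Finset.mem_univ x)
    simp only [M, Finset.coe_filter, Finset.mem_univ, true_and, Set.mem_ofPred_eq] at hx hy
    exact le_antisymm (hx y hxy') (hy x hxy'.symm)
  have hX : X.card ≤ (kreweras π).parts.card := by
    refine Finset.card_le_card_of_injOn (kreweras π).part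
      (fun x _ => (kreweras π).part_mem.2 (Finset.mem_univ x)) ?_
    intro x hx y hy hxy
    have hxy' : SameBlockIn (kreweras π) x y := by
      rw [← sameBlock_iff]
      change x ∈ (kreweras π).part y
      rw [← hxy]
      exact (kreweras π).mem_part_self.2 (Finset.mem_univ x)
    simp only [X, Finset.coe_filter, Finset.mem_univ, true_and, Set.mem_ofPred_eq] at hx hy
    exact le_antisymm (hy x hxy'.symm) (hx y hxy')
  -- If x is not the least element of its block, then (x - 1, c] cuts that block for every c ≥ x, so
  -- x - 1 is the last element of its K(π)-block. The last position is one more such element: as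
  -- subtraction in `Fin` wraps around, it could only be x - 1 for x = 0, and 0 lies in M.
  have hMX : Mᶜ.card + 1 ≤ X.card := by
    have hmaps : insert (Fin.last m) (Mᶜ.image fun x => x - 1) ⊆ X := by
      intro z hz
      rw [Finset.mem_insert, Finset.mem_image] at hz
      simp only [X, Finset.mem_filter, Finset.mem_univ, true_and]
      rcases hz with rfl | ⟨x, hx, rfl⟩
      · exact fun y _ => Fin.le_last y
      · simp only [M, Finset.mem_compl, Finset.mem_filter, Finset.mem_univ, true_and,
          not_forall, not_le] at hx
        obtain ⟨y, hxy, hyx⟩ := hx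
        intro c hc
        by_contra hlt
        have hx1 : (x - 1).1 = x.1 - 1 := by
          rw [Fin.val_sub_one_of_ne_zero]
          intro h0
          rw [h0] at hyx
          exact absurd hyx (Fin.not_lt_zero y)
        have := sameBlockIn_kreweras.1 hc x y hxy
        have h1 : ¬ x ≤ x - 1 := by omega
        have h2 : x ≤ c := by omega
        have h3 : y ≤ x - 1 := by omega
        have h4 : y ≤ c := by omega
        simp_all
    refine le_trans ?_ (Finset.card_le_card hmaps)
    rw [Finset.card_insert_of_notMem, Finset.card_image_of_injective _ (sub_left_injective)]
    rw [Finset.mem_image]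
    rintro ⟨x, hx, hxl⟩
    have : x = 0 := by
      rw [sub_eq_iff_eq_add] at hxl
      rw [hxl]
      exact Fin.last_add_one m
    subst this
    simp [M] at hx
  have := Finset.card_compl_add_card M
  rw [Fintype.card_fin] at this
  omega

end Partitions

/-! ### Transport of partitions along embeddings -/

section Push

variable {m n : ℕ} {V : Finset (Fin n)}

/-- The partition of the image `V` of an embedding `ι` induced by a partition of its domain. -/
def pushPart (ι : Fin m ↪ Fin n) (hV : Finset.univ.map ι = V) (π : Part m) : Finpartition V :=
  Finpartition.ofExistsUnique (π.parts.map (Finset.mapEmbedding ι).toEmbedding)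
    (by
      intro p hp
      obtain ⟨U, -, rfl⟩ := Finset.mem_map.1 hp
      rw [← hV]
      exact Finset.map_subset_map.2 (Finset.subset_univ U))
    (by
      intro a ha
      rw [← hV] at ha
      obtain ⟨i, -, rfl⟩ := Finset.mem_map.1 ha
      obtain ⟨U, ⟨hU, hi⟩, huniq⟩ := π.existsUnique_mem (Finset.mem_univ i)
      refine ⟨U.map ι, ⟨Finset.mem_map.2 ⟨U, hU, rfl⟩, Finset.mem_map_of_mem ι hi⟩, ?_⟩
      rintro W ⟨hW, hiW⟩
      obtain ⟨U', hU', rfl⟩ := Finset.mem_map.1 hW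
      have := huniq U' ⟨hU', (Finset.mem_map' ι).1 hiW⟩
      rw [this]
      rfl)
    (by
      intro h
      obtain ⟨U, hU, h⟩ := Finset.mem_map.1 h
      exact π.ne_empty hU (Finset.map_eq_empty.1 h))

variable {ι : Fin m ↪ Fin n} {hV : Finset.univ.map ι = V}

theorem exists_of_mem_image (hV : Finset.univ.map ι = V) {a : Fin n} (ha : a ∈ V) : ∃ i, ι i = a := by
  rw [← hV] at ha
  obtain ⟨i, -, rfl⟩ := Finset.mem_map.1 ha
  exact ⟨i, rfl⟩

theorem mem_of_image (hV : Finset.univ.map ι = V) (i : Fin m) : ι i ∈ V := by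
  rw [← hV]
  exact Finset.mem_map_of_mem ι (Finset.mem_univ i)

theorem sameBlockIn_pushPart {π : Part m} {i j : Fin m} :
    SameBlockIn (pushPart ι hV π) (ι i) (ι j) ↔ SameBlockIn π i j := by
  unfold SameBlockIn pushPart Finpartition.ofExistsUnique
  simp only [Finset.mem_map]
  constructor
  · rintro ⟨W, ⟨U, hU, rfl⟩, hi, hj⟩
    exact ⟨U, hU, (Finset.mem_map' ι).1 hi, (Finset.mem_map' ι).1 hj⟩
  · rintro ⟨U, hU, hi, hj⟩
    exact ⟨_, ⟨U, hU, rfl⟩, Finset.mem_map_of_mem ι hi, Finset.mem_map_of_mem ι hj⟩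

theorem pushPart_injective : Function.Injective (pushPart ι hV) := by
  intro π π' h
  apply finpartition_ext
  intro i j
  rw [← sameBlockIn_pushPart (ι := ι) (hV := hV), h, sameBlockIn_pushPart]

theorem prod_parts_pushPart {M : Type*} [CommMonoid M] (φ : Finset (Fin n) → M) (π : Part m) :
    ∏ U ∈ (pushPart ι hV π).parts, φ U = ∏ U ∈ π.parts, φ (U.map ι) := by
  unfold pushPart Finpartition.ofExistsUnique
  rw [Finset.prod_map]
  rfl

theorem pushPart_ext {P Q : Finpartition V} (hV : Finset.univ.map ι = V)
    (h : ∀ i j, SameBlockIn P (ι i) (ι j) ↔ SameBlockIn Q (ι i) (ι j)) : P = Q := by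
  apply finpartition_ext
  intro a b
  by_cases ha : a ∈ V
  · by_cases hb : b ∈ V
    · obtain ⟨i, rfl⟩ := exists_of_mem_image hV ha
      obtain ⟨j, rfl⟩ := exists_of_mem_image hV hb
      exact h i j
    · exact ⟨fun h => absurd h.mem_right hb, fun h => absurd h.mem_right hb⟩
  · exact ⟨fun h => absurd h.mem_left ha, fun h => absurd h.mem_left ha⟩

theorem forall_sameBlockIn_pushPart {π : Part m} {p : Fin n → Fin n → Prop} :
    (∀ a b, SameBlockIn (pushPart ι hV π) a b → p a b) ↔
      ∀ i j, SameBlockIn π i j → p (ι i) (ι j) := by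
  constructor
  · exact fun h i j hij => h _ _ (sameBlockIn_pushPart.2 hij)
  · intro h a b hab
    obtain ⟨i, rfl⟩ := exists_of_mem_image hV hab.mem_left
    obtain ⟨j, rfl⟩ := exists_of_mem_image hV hab.mem_right
    exact h i j (sameBlockIn_pushPart.1 hab)

open Classical in
theorem exists_pushPart_eq (hV : Finset.univ.map ι = V) (P : Finpartition V) :
    ∃ π, pushPart ι hV π = P := by
  let r : Setoid (Fin m) :=
    { r := fun i j => SameBlockIn P (ι i) (ι j)
      iseqv := ⟨fun i => sameBlockIn_self.2 (mem_of_image hV i), fun h => h.symm,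
        fun h h' => h.trans h'⟩ }
  refine ⟨Finpartition.ofSetSetoid r Finset.univ, pushPart_ext hV fun i j => ?_⟩
  rw [sameBlockIn_pushPart, sameBlockIn_ofSetSetoid]
  simp only [Finset.mem_univ, true_and]
  rfl

theorem isNonCrossingIn_pushPart (hι : StrictMono ι) {π : Part m} :
    IsNonCrossingIn (pushPart ι hV π) ↔ IsNonCrossing π := by
  rw [isNonCrossing_iff]
  constructor
  · intro h a b c d hab hbc hcd hac hbd
    have := h (ι a) (ι b) (ι c) (ι d) (hι hab) (hι hbc) (hι hcd)
      (sameBlockIn_pushPart.2 hac) (sameBlockIn_pushPart.2 hbd)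
    exact sameBlockIn_pushPart.1 this
  · intro h a b c d hab hbc hcd hac hbd
    obtain ⟨a, rfl⟩ := exists_of_mem_image hV hac.mem_left
    obtain ⟨c, rfl⟩ := exists_of_mem_image hV hac.mem_right
    obtain ⟨b, rfl⟩ := exists_of_mem_image hV hbd.mem_left
    obtain ⟨d, rfl⟩ := exists_of_mem_image hV hbd.mem_right
    rw [hι.lt_iff_lt] at hab hbc hcd
    rw [sameBlockIn_pushPart] at *
    exact h a b c d hab hbc hcd hac hbd

/-- The complement depends only on the relative order of the points, which a strictly monotone ι
preserves. -/
theorem krewerasIn_pushPart (hι : StrictMono ι) (π : Part m) :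
    krewerasIn (pushPart ι hV π) = pushPart ι hV (kreweras π) := by
  apply pushPart_ext hV
  intro i j
  rw [sameBlockIn_pushPart, sameBlockIn_krewerasIn, sameBlockIn_kreweras,
    forall_sameBlockIn_pushPart]
  simp only [hι.le_iff_le, mem_of_image hV, true_and]

end Push

/-! ### Mirror images and the bijectivity of Kreweras complementation -/

section Reverse

variable {n : ℕ}

/-- The mirror image of a partition. -/
def revPart (π : Part n) : Part n := pushPart Fin.revPerm.toEmbedding (by simp) π

theorem sameBlockIn_revPart {π : Part n} {i j : Fin n} :
    SameBlockIn (revPart π) i j ↔ SameBlockIn π i.rev j.rev := by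
  have := sameBlockIn_pushPart (ι := (Fin.revPerm (n := n)).toEmbedding) (V := Finset.univ)
    (hV := by simp) (π := π) (i := i.rev) (j := j.rev)
  rw [← this]
  simp [revPart]

theorem isNonCrossing_revPart {π : Part n} (hπ : IsNonCrossing π) : IsNonCrossing (revPart π) := by
  rw [isNonCrossing_iff] at *
  intro a b c d hab hbc hcd hac hbd
  rw [sameBlockIn_revPart] at *
  have := hπ d.rev c.rev b.rev a.rev (Fin.rev_lt_rev.2 hcd) (Fin.rev_lt_rev.2 hbc)
    (Fin.rev_lt_rev.2 hab) hbd.symm hac.symm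
  exact this.symm

theorem revPart_revPart (π : Part n) : revPart (revPart π) = π := by
  apply finpartition_ext
  intro i j
  simp [sameBlockIn_revPart]

/-- Mirrored Kreweras complementation is an involution. -/
theorem kreweras_revPart_kreweras {π : Part n} (hπ : IsNonCrossing π) :
    kreweras (revPart (kreweras π)) = revPart π := by
  apply finpartition_ext
  intro i j
  rw [sameBlockIn_kreweras, sameBlockIn_revPart, sameBlockIn_iff_kreweras hπ]
  -- Mirroring exchanges the half-open intervals (i, j] in the definition of K with the intervals
  -- [i, j) in `sameBlockIn_iff_kreweras`.
  have key : ∀ a i : Fin n, a.rev ≤ i ↔ ¬ a < i.rev := by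
    intro a i
    rw [not_lt, Fin.rev_le_iff]
  constructor
  · intro h a b hab
    have := h a.rev b.rev (by simpa [sameBlockIn_revPart] using hab)
    rw [key, key, key, key] at this
    tauto
  · intro h a b hab
    have := h a.rev b.rev (sameBlockIn_revPart.1 hab)
    have k1 := key a.rev
    have k2 := key b.rev
    simp only [Fin.rev_rev] at k1 k2
    rw [k1, k1, k2, k2]
    tauto

theorem exists_kreweras_eq {τ : Part n} (hτ : IsNonCrossing τ) :
    ∃ σ, IsNonCrossing σ ∧ kreweras σ = τ := by
  refine ⟨revPart (kreweras (revPart τ)), isNonCrossing_revPart (isNonCrossing_kreweras _), ?_⟩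
  rw [kreweras_revPart_kreweras (isNonCrossing_revPart hτ), revPart_revPart]

open Classical in
/-- For fixed `π`, the map `σ ↦ K_σ(π)` is a bijection from the non-crossing partitions above `π`
to those below `K(π)`. -/
theorem relKreweras_bijOn (π : Part n) :
    Set.BijOn (fun σ => relKreweras σ π) {σ | IsNonCrossing σ ∧ π ≤ σ}
      {ρ | IsNonCrossing ρ ∧ ρ ≤ kreweras π} := by
  let s : Finset (Part n) := {σ | IsNonCrossing σ ∧ π ≤ σ}
  let t : Finset (Part n) := {ρ | IsNonCrossing ρ ∧ ρ ≤ kreweras π}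
  have hmaps : Set.MapsTo (fun σ => relKreweras σ π) (s : Set (Part n)) t := by
    intro σ hσ
    simp only [s, t, Finset.coe_filter, Finset.mem_univ, true_and, Set.mem_ofPred_eq] at *
    exact ⟨isNonCrossing_relKreweras hσ.1 π, relKreweras_le_kreweras hσ.1 hσ.2⟩
  have hinj : Set.InjOn (fun σ => relKreweras σ π) (s : Set (Part n)) := by
    intro σ hσ σ' hσ' h
    simp only [s, Finset.coe_filter, Finset.mem_univ, true_and, Set.mem_ofPred_eq] at *
    apply kreweras_injOn hσ.1 hσ'.1
    rw [← relKreweras_kreweras hσ.1 hσ.2, ← relKreweras_kreweras hσ'.1 hσ'.2, h]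
  -- Surjectivity is obtained by counting: K itself, though a different map, already sends the
  -- partitions above π onto those below K(π).
  have hcard : t.card ≤ s.card := by
    refine Finset.card_le_card_of_surjOn kreweras ?_
    intro ρ hρ
    simp only [t, s, Finset.coe_filter, Finset.mem_univ, true_and, Set.mem_ofPred_eq] at *
    obtain ⟨σ, hσ, rfl⟩ := exists_kreweras_eq hρ.1
    exact ⟨σ, ⟨hσ, le_of_kreweras_le hσ hρ.2⟩, rfl⟩
  have := Finset.surjOn_of_injOn_of_card_le _ hmaps hinj hcard
  have hs : (s : Set (Part n)) = {σ | IsNonCrossing σ ∧ π ≤ σ} := by ext; simp [s]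
  have ht : (t : Set (Part n)) = {ρ | IsNonCrossing ρ ∧ ρ ≤ kreweras π} := by ext; simp [t]
  rw [← hs, ← ht]
  exact ⟨hmaps, hinj, this⟩

end Reverse

/-! ### Words -/

section Words

variable {s : ℕ}

theorem length_restrict (w : List (Fin s)) (V : Finset (Fin w.length)) :
    (restrict w V).length = V.card := by
  simp [restrict]

theorem restrict_univ (w : List (Fin s)) : restrict w Finset.univ = w := by
  unfold restrict
  rw [Fin.sort_univ]
  exact List.map_get_finRange w

theorem restrict_singleton (w : List (Fin s)) (i : Fin w.length) : restrict w {i} = [w.get i] := by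
  simp [restrict]

theorem restrict_ne_nil (w : List (Fin s)) {V : Finset (Fin w.length)} (hV : V.Nonempty) :
    restrict w V ≠ [] := by
  rw [← List.length_pos_iff, length_restrict]
  exact hV.card_pos

/-- The positions of the letters of `w|V` in `w`. -/
def restrictEmb (w : List (Fin s)) (V : Finset (Fin w.length)) :
    Fin (restrict w V).length ↪ Fin w.length :=
  (finCongr (length_restrict w V)).toEmbedding.trans
    (V.orderEmbOfFin rfl).toEmbedding

theorem restrictEmb_strictMono (w : List (Fin s)) (V : Finset (Fin w.length)) :
    StrictMono (restrictEmb w V) := by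
  intro i j hij
  exact (V.orderEmbOfFin rfl).strictMono (a := Fin.cast (length_restrict w V) i)
    (b := Fin.cast (length_restrict w V) j) hij

theorem map_restrictEmb (w : List (Fin s)) (V : Finset (Fin w.length)) :
    Finset.univ.map (restrictEmb w V) = V := by
  unfold restrictEmb
  rw [← Finset.map_map]
  simp

theorem get_restrict (w : List (Fin s)) (V : Finset (Fin w.length))
    (p : Fin (restrict w V).length) : (restrict w V).get p = w.get (restrictEmb w V p) := by
  exact List.getElem_map (l := V.sort) w.get (h := p.2)

theorem restrict_restrict (w : List (Fin s)) (V : Finset (Fin w.length))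
    (U : Finset (Fin (restrict w V).length)) :
    restrict (restrict w V) U = restrict w (U.map (restrictEmb w V)) := by
  change U.sort.map (restrict w V).get = (U.map (restrictEmb w V)).sort.map w.get
  rw [← StrictMonoOn.map_finsetSort (restrictEmb w V) U
    ((restrictEmb_strictMono w V).strictMonoOn _), List.map_map]
  apply List.map_congr_left
  intro p _
  exact get_restrict w V p

end Words

/-! ### Associativity of the boxed convolution -/

section Convolution

variable {s : ℕ} {R : Type u} [CommRing R]

theorem pseries_ext {f g : PSeries s R} (h : ∀ w, w ≠ [] → f.coeff w = g.coeff w) : f = g := by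
  obtain ⟨f, hf⟩ := f
  obtain ⟨g, hg⟩ := g
  congr
  funext w
  by_cases hw : w = []
  · subst hw
    exact hf.trans hg.symm
  · exact h w hw

/-- `∏_{U ∈ P} f_{w|U}` for a partition `P` of a set of positions of `w`. -/
def blockProd (f : PSeries s R) (w : List (Fin s)) {V : Finset (Fin w.length)}
    (P : Finpartition V) : R :=
  ∏ U ∈ P.parts, f.coeff (restrict w U)

theorem blockProd_bind (f : PSeries s R) (w : List (Fin s)) (σ : Part w.length)
    (Q : ∀ U ∈ σ.parts, Finpartition U) :
    blockProd f w (σ.bind Q) = ∏ U ∈ σ.parts.attach, blockProd f w (Q U.1 U.2) := by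
  unfold blockProd
  rw [Finpartition.bind_parts, Finset.prod_biUnion]
  rintro ⟨A, hA⟩ - ⟨B, hB⟩ - hAB
  rw [Function.onFun, Finset.disjoint_left]
  intro U hU hU'
  obtain ⟨i, hi⟩ := Finpartition.nonempty_of_mem_parts _ hU
  exact hAB (Subtype.ext (σ.eq_of_mem_parts hA hB (Finpartition.le _ hU hi)
    (Finpartition.le _ hU' hi)))

open Classical in
theorem boxConv_coeff (f g : PSeries s R) {w : List (Fin s)} (hw : w ≠ []) :
    (boxConv f g).coeff w = ∑ π : Part w.length with IsNonCrossing π,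
      blockProd f w π * blockProd g w (kreweras π) := if_neg hw

theorem blockProd_restrict (f : PSeries s R) (w : List (Fin s)) (V : Finset (Fin w.length))
    (π : Part (restrict w V).length) :
    blockProd f (restrict w V) π =
      blockProd f w (pushPart (restrictEmb w V) (map_restrictEmb w V) π) := by
  unfold blockProd
  rw [prod_parts_pushPart (fun U => f.coeff (restrict w U))]
  exact Finset.prod_congr rfl fun U _ => congrArg f.coeff (restrict_restrict w V U)

-- Partitions of the short word are transported to partitions of the set V of positions in w, so
-- that all later sums range over partitions of positions of one fixed word.
open Classical in
theorem boxConv_coeff_restrict (f g : PSeries s R) (w : List (Fin s))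
    {V : Finset (Fin w.length)} (hV : V.Nonempty) :
    (boxConv f g).coeff (restrict w V) = ∑ P : Finpartition V with IsNonCrossingIn P,
      blockProd f w P * blockProd g w (krewerasIn P) := by
  rw [boxConv_coeff f g (restrict_ne_nil w hV)]
  refine Finset.sum_bij (fun π _ => pushPart (restrictEmb w V) (map_restrictEmb w V) π)
    ?_ ?_ ?_ ?_
  · intro π hπ
    simp only [Finset.mem_filter, Finset.mem_univ, true_and] at *
    exact (isNonCrossingIn_pushPart (restrictEmb_strictMono w V)).2 hπ
  · exact fun π _ π' _ h => pushPart_injective h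
  · intro P hP
    obtain ⟨π, rfl⟩ := exists_pushPart_eq (map_restrictEmb w V) P
    refine ⟨π, ?_, rfl⟩
    simp only [Finset.mem_filter, Finset.mem_univ, true_and] at *
    exact (isNonCrossingIn_pushPart (restrictEmb_strictMono w V)).1 hP
  · intro π _
    rw [blockProd_restrict, blockProd_restrict, krewerasIn_pushPart (restrictEmb_strictMono w V)]

theorem restrictPart_bind {n : ℕ} {σ : Part n} (Q : ∀ U ∈ σ.parts, Finpartition U)
    {U : Finset (Fin n)} (hU : U ∈ σ.parts) :
    restrictPart (σ.bind Q) (Finset.subset_univ U) = Q U hU := by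
  apply finpartition_ext
  intro i j
  rw [sameBlockIn_restrictPart]
  constructor
  · rintro ⟨h, hi, -⟩
    exact (sameBlockIn_bind_of_mem hU hi).1 h
  · exact fun h => ⟨(sameBlockIn_bind_of_mem hU h.mem_left).2 h, h.mem_left, h.mem_right⟩

theorem bind_restrictPart {n : ℕ} {σ π : Part n} (h : π ≤ σ) :
    (σ.bind fun U _ => restrictPart π (Finset.subset_univ U)) = π := by
  apply finpartition_ext
  intro i j
  obtain ⟨U, hU, hi⟩ := σ.exists_mem (Finset.mem_univ i)
  rw [sameBlockIn_bind_of_mem hU hi, sameBlockIn_restrictPart]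
  refine ⟨fun h => h.1, fun hij => ⟨hij, hi, ?_⟩⟩
  exact (sameBlockIn_iff_mem hU hi).1 (le_iff_sameBlockIn.1 h i j hij)

theorem bind_le {n : ℕ} {σ : Part n} (Q : ∀ U ∈ σ.parts, Finpartition U) : σ.bind Q ≤ σ := by
  rw [le_iff_sameBlockIn]
  intro i j hij
  obtain ⟨U, hU, h⟩ := sameBlockIn_bind.1 hij
  exact ⟨U, hU, h.mem_left, h.mem_right⟩

theorem isNonCrossingIn_restrictPart {n : ℕ} {π : Part n} (hπ : IsNonCrossing π)
    (U : Finset (Fin n)) : IsNonCrossingIn (restrictPart π (Finset.subset_univ U)) := by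
  rw [isNonCrossing_iff] at hπ
  intro a b c d hab hbc hcd hac hbd
  rw [sameBlockIn_restrictPart] at *
  exact ⟨hπ a b c d hab hbc hcd hac.1 hbd.1, hac.2.2, hbd.2.1⟩

-- Expanding the product over the blocks of σ amounts to choosing a non-crossing partition of each
-- block. Such choices are the same as non-crossing π ≤ σ, and the complements inside the blocks
-- glue to K_σ(π).
open Classical in
theorem blockProd_boxConv (f g : PSeries s R) (w : List (Fin s)) {σ : Part w.length}
    (hσ : IsNonCrossing σ) :
    blockProd (boxConv f g) w σ = ∑ π : Part w.length with IsNonCrossing π ∧ π ≤ σ,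
      blockProd f w π * blockProd g w (relKreweras σ π) := by
  have h1 : blockProd (boxConv f g) w σ = ∏ U ∈ σ.parts,
      ∑ P ∈ ({P | IsNonCrossingIn P} : Finset (Finpartition U)),
        blockProd f w P * blockProd g w (krewerasIn P) :=
    Finset.prod_congr rfl fun U hU =>
      boxConv_coeff_restrict f g w (σ.nonempty_of_mem_parts hU)
  rw [h1, Finset.prod_sum]
  refine Finset.sum_bij (fun Q _ => σ.bind Q) ?_ ?_ ?_ ?_
  · intro Q hQ
    simp only [Finset.mem_pi, Finset.mem_filter, Finset.mem_univ, true_and] at *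
    exact ⟨isNonCrossing_bind hσ hQ, bind_le Q⟩
  · intro Q _ Q' _ h
    funext U hU
    rw [← restrictPart_bind Q hU, h, restrictPart_bind Q' hU]
  · intro π hπ
    simp only [Finset.mem_filter, Finset.mem_univ, true_and] at hπ
    refine ⟨fun U _ => restrictPart π (Finset.subset_univ U), ?_, bind_restrictPart hπ.2⟩
    simp only [Finset.mem_pi, Finset.mem_filter, Finset.mem_univ, true_and]
    exact fun U _ => isNonCrossingIn_restrictPart hπ.1 U
  · intro Q _
    rw [Finset.prod_mul_distrib, blockProd_bind, relKreweras, blockProd_bind]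
    congr 1
    exact Finset.prod_congr rfl fun U _ => by rw [restrictPart_bind Q U.2]

theorem boxConv_assoc (f g h : PSeries s R) :
    boxConv (boxConv f g) h = boxConv f (boxConv g h) := by
  classical
  apply pseries_ext
  intro w hw
  rw [boxConv_coeff _ _ hw, boxConv_coeff _ _ hw]
  have h1 : ∀ σ ∈ ({σ | IsNonCrossing σ} : Finset (Part w.length)),
      blockProd (boxConv f g) w σ * blockProd h w (kreweras σ) =
        ∑ π : Part w.length with IsNonCrossing π ∧ π ≤ σ,
          blockProd f w π * blockProd g w (relKreweras σ π) * blockProd h w (kreweras σ) := by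
    intro σ hσ
    rw [blockProd_boxConv f g w (Finset.mem_filter.1 hσ).2, Finset.sum_mul]
  -- The inner sum runs over ρ ≤ K(π). Substituting ρ = K_σ(π) turns the last factor K_{K(π)}(ρ)
  -- into K(σ), and the terms agree with those of `h1`.
  have h2 : ∀ π ∈ ({π | IsNonCrossing π} : Finset (Part w.length)),
      blockProd f w π * blockProd (boxConv g h) w (kreweras π) =
        ∑ σ : Part w.length with IsNonCrossing σ ∧ π ≤ σ,
          blockProd f w π * blockProd g w (relKreweras σ π) * blockProd h w (kreweras σ) := by
    intro π _
    rw [blockProd_boxConv g h w (isNonCrossing_kreweras π), Finset.mul_sum]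
    obtain ⟨hm, hi, hs⟩ := relKreweras_bijOn π
    symm
    refine Finset.sum_bij (fun σ _ => relKreweras σ π) ?_ ?_ ?_ ?_
    · intro σ hσ
      simpa using hm (by simpa using hσ)
    · exact fun σ hσ σ' hσ' e => hi (by simpa using hσ) (by simpa using hσ') e
    · intro ρ hρ
      obtain ⟨σ, hσ, e⟩ := hs (a := ρ) (by simpa using hρ)
      exact ⟨σ, by simpa using hσ, e⟩
    · intro σ hσ
      simp only [Finset.mem_filter, Finset.mem_univ, true_and] at hσ
      rw [relKreweras_kreweras hσ.1 hσ.2, mul_assoc]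
  rw [Finset.sum_congr rfl h1, Finset.sum_congr rfl h2]
  apply Finset.sum_comm'
  simp
  tauto

end Convolution

/-! ### The extreme partitions -/

section Extreme

variable {n : ℕ}

theorem isNonCrossing_bot : IsNonCrossing (⊥ : Part n) := by
  rw [isNonCrossing_iff]
  intro a b c d hab hbc _ hac _
  rw [sameBlockIn_bot] at hac
  exact absurd (hab.trans hbc) (by rw [hac.2]; exact lt_irrefl c)

/-- From here on `kreweras ⊥` plays the role of the partition with a single block. -/
theorem sameBlockIn_kreweras_bot (i j : Fin n) : SameBlockIn (kreweras (⊥ : Part n)) i j := by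
  rw [sameBlockIn_kreweras]
  intro a b hab
  rw [(sameBlockIn_bot.1 hab).2]

theorem eq_bot_of_sameBlockIn {π : Part n} (h : ∀ i j, i < j → ¬ SameBlockIn π i j) :
    π = ⊥ := by
  apply finpartition_ext
  intro i j
  rw [sameBlockIn_bot]
  refine ⟨fun hij => ⟨Finset.mem_univ i, ?_⟩, fun hij => hij.2 ▸ sameBlockIn_refl π i⟩
  by_contra hne
  rcases lt_or_gt_of_ne hne with hlt | hlt
  · exact h i j hlt hij
  · exact h j i hlt hij.symm

/-- The interval (i, j] contains j but not i, so it cuts their common block. -/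
theorem not_sameBlockIn_kreweras {π : Part n} {i j : Fin n} (hij : i < j)
    (h : SameBlockIn π i j) : ¬ SameBlockIn (kreweras π) i j := by
  intro hK
  have := sameBlockIn_kreweras.1 hK i j h
  have h1 : i ≤ j := hij.le
  have h2 : ¬ j ≤ i := not_le.2 hij
  simp_all

theorem eq_bot_of_sameBlockIn_kreweras {π : Part n}
    (h : ∀ i j, SameBlockIn (kreweras π) i j) : π = ⊥ :=
  eq_bot_of_sameBlockIn fun i j hij hπ => not_sameBlockIn_kreweras hij hπ (h i j)

theorem kreweras_kreweras_bot : kreweras (kreweras (⊥ : Part n)) = ⊥ :=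
  eq_bot_of_sameBlockIn fun _ _ hij => not_sameBlockIn_kreweras hij (sameBlockIn_kreweras_bot _ _)

theorem eq_kreweras_bot_of_kreweras_eq_bot {π : Part n} (hπ : IsNonCrossing π)
    (h : kreweras π = ⊥) : π = kreweras ⊥ :=
  kreweras_injOn hπ (isNonCrossing_kreweras _) (h.trans kreweras_kreweras_bot.symm)

theorem parts_eq_of_univ_mem {π : Part n} (h : Finset.univ ∈ π.parts) :
    π.parts = {Finset.univ} := by
  ext U
  rw [Finset.mem_singleton]
  constructor
  · intro hU
    obtain ⟨i, hi⟩ := π.nonempty_of_mem_parts hU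
    exact π.eq_of_mem_parts hU h hi (Finset.mem_univ i)
  · rintro rfl
    exact h

theorem parts_kreweras_bot (hn : n ≠ 0) : (kreweras (⊥ : Part n)).parts = {Finset.univ} := by
  apply parts_eq_of_univ_mem
  obtain ⟨U, hU, hi⟩ := (kreweras (⊥ : Part n)).exists_mem
    (Finset.mem_univ (⟨0, Nat.pos_of_ne_zero hn⟩ : Fin n))
  convert hU
  symm
  rw [Finset.eq_univ_iff_forall]
  exact fun j => (sameBlockIn_iff_mem hU hi).1 (sameBlockIn_kreweras_bot _ j)

/-- This makes recursion on the length of words possible: terms with π ≠ ⊥ involve the second factor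
only at shorter words. -/
theorem card_lt_of_mem_kreweras {π : Part n} (hπ : π ≠ ⊥) {U : Finset (Fin n)}
    (hU : U ∈ (kreweras π).parts) : U.card < n := by
  by_contra hc
  have hle := Finset.card_le_univ U
  rw [Fintype.card_fin] at hle
  have hcard : U.card = Fintype.card (Fin n) := by rw [Fintype.card_fin]; omega
  have huniv : U = Finset.univ := (Finset.card_eq_iff_eq_univ U).1 hcard
  exact hπ (eq_bot_of_sameBlockIn_kreweras fun i j => ⟨U, hU, by simp [huniv], by simp [huniv]⟩)

end Extreme

/-! ### Unit, inverses, base change, and commutativity in one variable -/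

section Group

variable {s : ℕ} {R : Type u} [CommRing R]

theorem blockProd_bot (f : PSeries s R) (w : List (Fin s)) :
    blockProd f w (⊥ : Part w.length) = ∏ i, f.coeff [w.get i] := by
  unfold blockProd
  rw [Finpartition.parts_bot, Finset.prod_map]
  exact Finset.prod_congr rfl fun i _ => congrArg f.coeff (restrict_singleton w i)

theorem blockProd_kreweras_bot (f : PSeries s R) {w : List (Fin s)} (hw : w ≠ []) :
    blockProd f w (kreweras (⊥ : Part w.length)) = f.coeff w := by
  unfold blockProd
  rw [parts_kreweras_bot (by simpa using hw), Finset.prod_singleton, restrict_univ]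

/-- If all coefficients of the words of length at least two vanish, only the partition into
singletons contributes. -/
theorem eq_bot_of_blockProd_ne_zero {f : PSeries s R} (hf : ∀ u, 1 < u.length → f.coeff u = 0)
    {w : List (Fin s)} {π : Part w.length} (h : blockProd f w π ≠ 0) : π = ⊥ := by
  refine eq_bot_of_sameBlockIn fun i j hij ⟨U, hU, hi, hj⟩ => h ?_
  refine Finset.prod_eq_zero hU (hf _ ?_)
  rw [length_restrict, Finset.one_lt_card]
  exact ⟨i, hi, j, hj, hij.ne⟩

open Classical in
/-- The term of the trivial partition, which is linear in `g_w`, and the others, which involve only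
coefficients of `g` at shorter words. -/
theorem boxConv_coeff_eq_add (f g : PSeries s R) {w : List (Fin s)} (hw : w ≠ []) :
    (boxConv f g).coeff w = (∏ i, f.coeff [w.get i]) * g.coeff w +
      ∑ π : Part w.length with IsNonCrossing π ∧ π ≠ ⊥,
        blockProd f w π * blockProd g w (kreweras π) := by
  rw [boxConv_coeff f g hw, ← Finset.add_sum_erase _ _ (a := ⊥)
    (by simp [isNonCrossing_bot]), blockProd_bot, blockProd_kreweras_bot g hw]
  congr 2
  ext π
  simp only [Finset.mem_erase, Finset.mem_filter, Finset.mem_univ, true_and]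
  tauto

theorem boxConv_coeff_singleton (f g : PSeries s R) (i : Fin s) :
    (boxConv f g).coeff [i] = f.coeff [i] * g.coeff [i] := by
  classical
  rw [boxConv_coeff_eq_add f g (by simp), Finset.sum_eq_zero, add_zero]
  · simp
  · intro π hπ
    simp only [Finset.mem_filter, Finset.mem_univ, true_and] at hπ
    exact absurd (eq_bot_of_sameBlockIn fun i j hij => absurd hij
      (by rw [Subsingleton.elim (α := Fin 1) i j]; exact lt_irrefl _)) hπ.2

theorem boxConv_coeff_eq_zero {f g : PSeries s R} (hf : ∀ u, 1 < u.length → f.coeff u = 0)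
    (hg : ∀ u, 1 < u.length → g.coeff u = 0) {w : List (Fin s)} (hw : 1 < w.length) :
    (boxConv f g).coeff w = 0 := by
  classical
  rw [boxConv_coeff_eq_add f g (by rintro rfl; simp at hw), hg w hw, mul_zero, zero_add]
  refine Finset.sum_eq_zero fun π hπ => ?_
  simp only [Finset.mem_filter, Finset.mem_univ, true_and] at hπ
  rw [not_imp_comm.1 (eq_bot_of_blockProd_ne_zero hf) hπ.2, zero_mul]

/-- The unit series `z₁ + ⋯ + z_s`. -/
def oneSeries (s : ℕ) (R : Type u) [CommRing R] : PSeries s R :=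
  ⟨fun w => if w.length = 1 then 1 else 0, by simp⟩

/-- Only terms with K(π) = ⊥ survive, and by injectivity of K this leaves the one-block partition.
-/
theorem boxConv_one (f : PSeries s R) : boxConv f (oneSeries s R) = f := by
  classical
  apply pseries_ext
  intro w hw
  rw [boxConv_coeff _ _ hw, Finset.sum_eq_single (kreweras ⊥)]
  · rw [blockProd_kreweras_bot f hw, kreweras_kreweras_bot, blockProd_bot]
    simp [oneSeries]
  · intro π hπ hne
    by_contra h
    have hK : kreweras π = ⊥ :=
      eq_bot_of_blockProd_ne_zero (fun u hu => if_neg hu.ne') (right_ne_zero_of_mul h)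
    exact hne (eq_kreweras_bot_of_kreweras_eq_bot (Finset.mem_filter.1 hπ).2 hK)
  · simp [isNonCrossing_kreweras]

open Classical in
/-- The coefficients of the inverse series, where `c i` is the inverse of `f_{(i)}`. -/
def invCoeff (f : PSeries s R) (c : Fin s → R) (w : List (Fin s)) : R :=
  if w = [] then 0 else
    (∏ i, c (w.get i)) * ((oneSeries s R).coeff w -
      ∑ π : Part w.length with IsNonCrossing π ∧ π ≠ ⊥,
        blockProd f w π * ∏ U ∈ (kreweras π).parts,
          -- The test serves termination only. It always succeeds here by `card_lt_of_mem_kreweras`,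
          -- so the default value 0 is never taken.
          if U.card < w.length then invCoeff f c (restrict w U) else 0)
termination_by w.length
decreasing_by rwa [length_restrict]

/-- The inverse of `f` for the boxed convolution. -/
def invSeries (f : PSeries s R) (c : Fin s → R) : PSeries s R :=
  ⟨invCoeff f c, by rw [invCoeff, if_pos rfl]⟩

theorem boxConv_invSeries (f : PSeries s R) (c : Fin s → R) (hc : ∀ i, f.coeff [i] * c i = 1) :
    boxConv f (invSeries f c) = oneSeries s R := by
  classical
  apply pseries_ext
  intro w hw
  rw [boxConv_coeff_eq_add _ _ hw]
  change _ * invCoeff f c w + _ = _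
  rw [invCoeff, if_neg hw, ← mul_assoc, ← Finset.prod_mul_distrib,
    Finset.prod_eq_one fun i _ => hc _, one_mul]
  have h : ∀ π ∈ ({π | IsNonCrossing π ∧ π ≠ ⊥} : Finset (Part w.length)),
      blockProd f w π * blockProd (invSeries f c) w (kreweras π) =
      blockProd f w π * ∏ U ∈ (kreweras π).parts,
          if U.card < w.length then invCoeff f c (restrict w U) else 0 := by
    intro π hπ
    congr 1
    refine Finset.prod_congr rfl fun U hU => ?_
    rw [if_pos (card_lt_of_mem_kreweras (Finset.mem_filter.1 hπ).2.2 hU)]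
    rfl
  rw [Finset.sum_congr rfl h, sub_add_cancel]

theorem PSeries.blockProd_map {k : Type u} [CommRing k] {R' : Type u} [CommRing R'] [Algebra k R]
    [Algebra k R'] (φ : R →ₐ[k] R') (f : PSeries s R) (w : List (Fin s))
    {V : Finset (Fin w.length)} (P : Finpartition V) :
    blockProd (f.map φ) w P = φ (blockProd f w P) := by
  unfold blockProd
  rw [map_prod]
  rfl

theorem PSeries.map_boxConv {k : Type u} [CommRing k] {R' : Type u} [CommRing R'] [Algebra k R]
    [Algebra k R'] (φ : R →ₐ[k] R') (f g : PSeries s R) :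
    (boxConv f g).map φ = boxConv (f.map φ) (g.map φ) := by
  classical
  apply pseries_ext
  intro w hw
  change φ ((boxConv f g).coeff w) = _
  rw [boxConv_coeff _ _ hw, boxConv_coeff _ _ hw, map_sum]
  simp only [map_mul, PSeries.blockProd_map]

/-- For one variable the boxed convolution is commutative. -/
theorem boxConv_comm (f g : PSeries 1 R) : boxConv f g = boxConv g f := by
  classical
  apply pseries_ext
  intro w hw
  -- With a single letter a word is determined by its length, so mirroring a partition does not
  -- change the product over its blocks.
  have hrev : ∀ (f : PSeries 1 R) (π : Part w.length),
      blockProd f w (revPart π) = blockProd f w π := by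
    intro f π
    unfold blockProd revPart
    rw [prod_parts_pushPart (fun U => f.coeff (restrict w U))]
    refine Finset.prod_congr rfl fun U _ => congrArg f.coeff ?_
    apply List.ext_getElem
    · rw [length_restrict, length_restrict, Finset.card_map]
    · exact fun _ _ _ => Subsingleton.elim _ _
  rw [boxConv_coeff _ _ hw, boxConv_coeff _ _ hw]
  have hmem : ∀ π ∈ ({π | IsNonCrossing π} : Finset (Part w.length)),
      revPart (kreweras π) ∈ ({π | IsNonCrossing π} : Finset (Part w.length)) := fun π _ => by
    simpa using isNonCrossing_revPart (isNonCrossing_kreweras π)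
  have hinv : ∀ π ∈ ({π | IsNonCrossing π} : Finset (Part w.length)),
      revPart (kreweras (revPart (kreweras π))) = π := fun π hπ => by
    rw [kreweras_revPart_kreweras (Finset.mem_filter.1 hπ).2, revPart_revPart]
  -- The involution π ↦ mirror of K(π) interchanges, up to mirroring, π and its complement, hence
  -- the roles of f and g.
  refine Finset.sum_bij' (fun π _ => revPart (kreweras π)) (fun π _ => revPart (kreweras π))
    hmem hmem hinv hinv ?_
  intro π hπ
  rw [hrev, kreweras_revPart_kreweras (Finset.mem_filter.1 hπ).2, hrev, mul_comm]

end Group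

/-! ### Non-commutativity in at least two variables -/

section NonComm

variable {s : ℕ}

open Classical in
/-- The series `∑ zᵢ + z_a z_b`. -/
def pairSeries (R : Type u) [CommRing R] (a b : Fin s) : PSeries s R :=
  ⟨fun w => if w.length = 1 ∨ w = [a, b] then 1 else 0, by simp⟩

theorem pairSeries_coeff_singleton (R : Type u) [CommRing R] (a b i : Fin s) :
    (pairSeries R a b).coeff [i] = 1 := by
  simp [pairSeries]

theorem restrict_pair (w : List (Fin s)) {i j : Fin w.length} (hij : i < j) :
    restrict w {i, j} = [w.get i, w.get j] := by
  unfold restrict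
  rw [Finset.sort_insert]
  · simp
  · simpa using hij.le
  · simpa using hij.ne

/-- In a non-zero product every block is a singleton or a pair spelling ab. The relational form lets
it be applied to π and to K(π) alike. -/
theorem get_of_blockProd_pairSeries_ne_zero {R : Type u} [CommRing R] {a b : Fin s}
    {w : List (Fin s)} {V : Finset (Fin w.length)} {P : Finpartition V}
    (h : blockProd (pairSeries R a b) w P ≠ 0)
    {i j : Fin w.length} (hij : i < j) (hP : SameBlockIn P i j) :
    w.get i = a ∧ w.get j = b := by
  classical
  obtain ⟨U, hU, hi, hj⟩ := hP
  have hcard : 1 < U.card := Finset.one_lt_card.2 ⟨i, hi, j, hj, hij.ne⟩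
  have hne : (pairSeries R a b).coeff (restrict w U) ≠ 0 :=
    fun h0 => h (Finset.prod_eq_zero hU h0)
  have hU' : restrict w U = [a, b] := by
    by_contra hc
    refine hne (if_neg ?_)
    rw [length_restrict]
    rintro (h1 | h1)
    · omega
    · exact hc h1
  have hcard2 : U.card = 2 := by rw [← length_restrict, hU']; rfl
  have hUij : {i, j} = U := Finset.eq_of_subset_of_card_le
    (by intro x; simp only [Finset.mem_insert, Finset.mem_singleton]; rintro (rfl | rfl) <;> assumption)
    (by rw [hcard2, Finset.card_pair hij.ne])
  rw [← hUij, restrict_pair w hij] at hU'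
  simpa using hU'

/-- The partition `{1, 2}, {3}`. -/
def leftPair : Part 3 :=
  Finpartition.ofExistsUnique {{0, 1}, {2}} (by decide) (by unfold ExistsUnique; decide) (by decide)

/-- The partition `{1}, {2, 3}`. -/
def rightPair : Part 3 :=
  Finpartition.ofExistsUnique {{0}, {1, 2}} (by decide) (by unfold ExistsUnique; decide) (by decide)

theorem sameBlockIn_leftPair {i j : Fin 3} : SameBlockIn leftPair i j ↔ (i = 2 ↔ j = 2) := by
  change (∃ U ∈ ({{0, 1}, {2}} : Finset (Finset (Fin 3))), _) ↔ _
  revert i j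
  decide

theorem sameBlockIn_rightPair {i j : Fin 3} : SameBlockIn rightPair i j ↔ (i = 0 ↔ j = 0) := by
  change (∃ U ∈ ({{0}, {1, 2}} : Finset (Finset (Fin 3))), _) ↔ _
  revert i j
  decide

theorem kreweras_leftPair : kreweras leftPair = rightPair := by
  apply finpartition_ext
  intro i j
  rw [sameBlockIn_kreweras, sameBlockIn_rightPair]
  simp only [sameBlockIn_leftPair]
  revert i j
  decide

theorem isNonCrossing_leftPair : IsNonCrossing leftPair := by
  rw [isNonCrossing_iff]
  intro a b c d hab hbc hcd _ _
  omega

theorem get_eq_left {a b : Fin s} (hab : a ≠ b) {i j : Fin 3} (hij : i < j)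
    (h : [a, b, a].get i = a ∧ [a, b, a].get j = b) : i = 0 ∧ j = 1 := by
  fin_cases i <;> fin_cases j <;> simp_all

theorem get_eq_right {a b : Fin s} (hab : a ≠ b) {i j : Fin 3} (hij : i < j)
    (h : [a, b, a].get i = b ∧ [a, b, a].get j = a) : i = 1 ∧ j = 2 := by
  fin_cases i <;> fin_cases j <;> simp_all

theorem eq_leftPair {π : Part 3} (h : ∀ i j, i < j → SameBlockIn π i j → i = 0 ∧ j = 1)
    (h01 : SameBlockIn π 0 1) : π = leftPair := by
  have h02 : ¬ SameBlockIn π 0 2 := fun h' => by simpa using h 0 2 (by decide) h'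
  have h12 : ¬ SameBlockIn π 1 2 := fun h' => by simpa using h 1 2 (by decide) h'
  apply finpartition_ext
  intro i j
  rw [sameBlockIn_leftPair]
  have hc := sameBlockIn_comm (P := π) (i := i) (j := j)
  have hr := sameBlockIn_refl π i
  fin_cases i <;> fin_cases j <;> simp_all

theorem blockProd_pairSeries_leftPair (R : Type u) [CommRing R] (a b : Fin s) :
    blockProd (pairSeries R a b) [a, b, a] (leftPair : Part [a, b, a].length) = 1 := by
  classical
  refine Finset.prod_eq_one fun U hU => if_pos ?_
  have hU' : U ∈ ({{0, 1}, {2}} : Finset (Finset (Fin 3))) := hU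
  simp only [Finset.mem_insert, Finset.mem_singleton] at hU'
  rcases hU' with rfl | rfl
  · exact Or.inr (restrict_pair [a, b, a] (i := (0 : Fin 3)) (j := (1 : Fin 3)) Fin.zero_lt_one)
  · exact Or.inl (by rw [length_restrict]; rfl)

theorem blockProd_pairSeries_rightPair (R : Type u) [CommRing R] (a b : Fin s) :
    blockProd (pairSeries R b a) [a, b, a] (rightPair : Part [a, b, a].length) = 1 := by
  classical
  refine Finset.prod_eq_one fun U hU => if_pos ?_
  have hU' : U ∈ ({{0}, {1, 2}} : Finset (Finset (Fin 3))) := hU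
  simp only [Finset.mem_insert, Finset.mem_singleton] at hU'
  rcases hU' with rfl | rfl
  · exact Or.inl (by rw [length_restrict]; rfl)
  · exact Or.inr (restrict_pair [a, b, a] (i := (1 : Fin 3)) (j := (2 : Fin 3)) (Fin.lt_def.2 Nat.one_lt_two))

/-- In aba only the first two letters spell ab and only the last two spell ba. So π joins at most
the first two positions and K(π) at most the last two; π = ⊥ is excluded because its complement
joins everything. -/
theorem boxConv_pairSeries (R : Type u) [CommRing R] {a b : Fin s} (hab : a ≠ b) :
    (boxConv (pairSeries R a b) (pairSeries R b a)).coeff [a, b, a] = 1 := by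
  classical
  rw [boxConv_coeff _ _ (by simp), Finset.sum_eq_single (leftPair : Part [a, b, a].length)]
  · rw [blockProd_pairSeries_leftPair, one_mul]
    exact (congrArg (blockProd (pairSeries R b a) [a, b, a]) kreweras_leftPair).trans
      (blockProd_pairSeries_rightPair R a b)
  · intro π hπ hne
    by_contra h
    have hf : ∀ i j : Fin 3, i < j → SameBlockIn π i j → i = 0 ∧ j = 1 := fun i j hij h' =>
      get_eq_left hab hij
        (get_of_blockProd_pairSeries_ne_zero (left_ne_zero_of_mul h) (i := i) (j := j) hij h')
    have hg : ∀ i j : Fin 3, i < j → SameBlockIn (kreweras π) i j → i = 1 ∧ j = 2 :=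
      fun i j hij h' => get_eq_right hab hij
        (get_of_blockProd_pairSeries_ne_zero (right_ne_zero_of_mul h) (i := i) (j := j) hij h')
    by_cases h01 : SameBlockIn (n := 3) π 0 1
    · exact hne (eq_leftPair hf h01)
    · have hbot : π = ⊥ := eq_bot_of_sameBlockIn fun i j hij h' => by
        obtain ⟨rfl, rfl⟩ := hf i j hij h'
        exact h01 h'
      subst hbot
      exact absurd (hg 0 1 (by decide) (sameBlockIn_kreweras_bot _ _)).1 (by decide)
  · intro h
    exact absurd (Finset.mem_filter.2 ⟨Finset.mem_univ _, isNonCrossing_leftPair⟩) h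

/-- Now π joins at most the last two positions, so (0, 2] cuts no block and K(π) joins the two outer
positions, which do not spell ab. -/
theorem boxConv_pairSeries_swap (R : Type u) [CommRing R] {a b : Fin s} (hab : a ≠ b) :
    (boxConv (pairSeries R b a) (pairSeries R a b)).coeff [a, b, a] = 0 := by
  classical
  rw [boxConv_coeff _ _ (by simp)]
  refine Finset.sum_eq_zero fun π hπ => ?_
  by_contra h
  have hf : ∀ i j : Fin 3, i < j → SameBlockIn π i j → i = 1 ∧ j = 2 := fun i j hij h' =>
    get_eq_right hab hij
      (get_of_blockProd_pairSeries_ne_zero (left_ne_zero_of_mul h) (i := i) (j := j) hij h')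
  have hg : ∀ i j : Fin 3, i < j → SameBlockIn (kreweras π) i j → i = 0 ∧ j = 1 :=
    fun i j hij h' => get_eq_left hab hij
      (get_of_blockProd_pairSeries_ne_zero (right_ne_zero_of_mul h) (i := i) (j := j) hij h')
  have h02 : SameBlockIn (n := 3) (kreweras π) 0 2 := by
    rw [sameBlockIn_kreweras]
    intro x y hxy
    rcases lt_trichotomy x y with hlt | rfl | hlt
    · obtain ⟨rfl, rfl⟩ := hf x y hlt hxy
      decide
    · rfl
    · obtain ⟨rfl, rfl⟩ := hf y x hlt hxy.symm
      decide
  exact absurd (hg 0 2 (by decide) h02).2 (by decide)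

end NonComm

/-! ### Group functors inside the series -/

section GroupFunctor

variable {k : Type u} [CommRing k] {s : ℕ}

theorem one_boxConv {R : Type u} [CommRing R] (g : PSeries s R) :
    boxConv (oneSeries s R) g = g := by
  classical
  apply pseries_ext
  intro w hw
  rw [boxConv_coeff_eq_add _ _ hw, Finset.sum_eq_zero, add_zero,
    Finset.prod_eq_one fun i _ => by simp [oneSeries], one_mul]
  intro π hπ
  rw [not_imp_comm.1 (eq_bot_of_blockProd_ne_zero fun u hu => if_neg hu.ne')
    (Finset.mem_filter.1 hπ).2.2, zero_mul]

/-- A subfunctor of the series which is closed under the operations of a group. -/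
structure IsClosedUnderBoxConv (F : Subfunctor (seriesFunctor k s)) : Prop where
  one_mem : ∀ R : CommAlgCat.{u} k, oneSeries s R ∈ F.obj R
  mul_mem : ∀ (R : CommAlgCat.{u} k) (f g : PSeries s R), f ∈ F.obj R → g ∈ F.obj R →
    boxConv f g ∈ F.obj R
  exists_inv : ∀ (R : CommAlgCat.{u} k) (f : PSeries s R), f ∈ F.obj R →
    ∃ g : PSeries s R, g ∈ F.obj R ∧ boxConv f g = oneSeries s R

/-- If g is a right inverse of f and h one of g, associativity gives f = h. -/
theorem IsClosedUnderBoxConv.exists_two_sided_inv {F : Subfunctor (seriesFunctor k s)}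
    (hF : IsClosedUnderBoxConv F) {R : CommAlgCat.{u} k} {f : PSeries s R} (hf : f ∈ F.obj R) :
    ∃ g : PSeries s R, g ∈ F.obj R ∧ boxConv f g = oneSeries s R ∧
      boxConv g f = oneSeries s R := by
  obtain ⟨g, hg, hfg⟩ := hF.exists_inv R f hf
  obtain ⟨h, -, hgh⟩ := hF.exists_inv R g hg
  refine ⟨g, hg, hfg, ?_⟩
  have : f = h := by
    rw [← boxConv_one f, ← hgh, ← boxConv_assoc, hfg, one_boxConv]
  rw [this, hgh]

/-- The group functor structure on a closed subfunctor. -/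
def IsClosedUnderBoxConv.boxGroup {F : Subfunctor (seriesFunctor k s)}
    (hF : IsClosedUnderBoxConv F) : BoxGroup F where
  group R :=
    letI : Mul (F.toFunctor.obj R) := ⟨fun f g => ⟨boxConv (R := R) f.1 g.1,
      hF.mul_mem R f.1 g.1 f.2 g.2⟩⟩
    letI : One (F.toFunctor.obj R) := ⟨⟨oneSeries s R, hF.one_mem R⟩⟩
    letI : Inv (F.toFunctor.obj R) := ⟨fun f => ⟨(hF.exists_inv R f.1 f.2).choose,
      (hF.exists_inv R f.1 f.2).choose_spec.1⟩⟩
    Group.ofRightAxioms (fun _ _ _ => Subtype.ext (boxConv_assoc _ _ _))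
      (fun _ => Subtype.ext (boxConv_one _))
      (fun f => Subtype.ext (hF.exists_inv R f.1 f.2).choose_spec.2)
  mul_eq _ _ _ := rfl
  map_mul φ f g := Subtype.ext (PSeries.map_boxConv φ.hom f.1 g.1)

end GroupFunctor

/-! ### Hopf algebras from universal series -/

section Universal

variable {k : Type u} [CommRing k] {s : ℕ} {A : Type u} [CommRing A] [Algebra k A]

theorem PSeries.map_map {R R' R'' : Type u} [CommRing R] [CommRing R'] [CommRing R'']
    [Algebra k R] [Algebra k R'] [Algebra k R''] (φ : R →ₐ[k] R') (ψ : R' →ₐ[k] R'')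
    (f : PSeries s R) : (f.map φ).map ψ = f.map (ψ.comp φ) := rfl

theorem oneSeries_map {R R' : Type u} [CommRing R] [CommRing R'] [Algebra k R] [Algebra k R']
    (φ : R →ₐ[k] R') : (oneSeries s R).map φ = oneSeries s R' := by
  apply pseries_ext
  intro w _
  change φ (if _ then _ else _) = if _ then _ else _
  split_ifs <;> simp

/-- The first inclusion `a ↦ a ⊗ 1`. -/
abbrev inl (k : Type u) [CommRing k] (A B : Type u) [CommRing A] [Algebra k A] [CommRing B]
    [Algebra k B] : A →ₐ[k] A ⊗[k] B := Algebra.TensorProduct.includeLeft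

/-- The second inclusion `b ↦ 1 ⊗ b`. -/
abbrev inr (k : Type u) [CommRing k] (A B : Type u) [CommRing A] [Algebra k A] [CommRing B]
    [Algebra k B] : B →ₐ[k] A ⊗[k] B := Algebra.TensorProduct.includeRight

/-- The series `U` with coefficients in `A` is universal among the elements of the functor `F`. -/
structure IsUniversal (F : Subfunctor (seriesFunctor k s)) (U : PSeries s A) : Prop where
  mem : U ∈ F.obj (CommAlgCat.of k A)
  exists_lift : ∀ (R : CommAlgCat.{u} k) (f : PSeries s R), f ∈ F.obj R →
    ∃ φ : A →ₐ[k] R, U.map φ = f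
  hom_ext : ∀ {R : Type u} [CommRing R] [Algebra k R] {φ ψ : A →ₐ[k] R},
    U.map φ = U.map ψ → φ = ψ

variable {F : Subfunctor (seriesFunctor k s)} {U : PSeries s A}

theorem IsUniversal.map_mem (hU : IsUniversal F U) {R : Type u} [CommRing R] [Algebra k R]
    (φ : A →ₐ[k] R) : U.map φ ∈ F.obj (CommAlgCat.of k R) :=
  F.map (CommAlgCat.ofHom φ) hU.mem

theorem IsUniversal.exists_comul (hU : IsUniversal F U) (hF : IsClosedUnderBoxConv F) :
    ∃ φ : A →ₐ[k] A ⊗[k] A, U.map φ = boxConv (U.map (inl k A A))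
      (U.map (inr k A A)) :=
  hU.exists_lift (CommAlgCat.of k (A ⊗[k] A)) _
    (hF.mul_mem (CommAlgCat.of k (A ⊗[k] A)) _ _ (hU.map_mem _) (hU.map_mem _))

theorem IsUniversal.exists_counit (hU : IsUniversal F U) (hF : IsClosedUnderBoxConv F) :
    ∃ φ : A →ₐ[k] k, U.map φ = oneSeries s k :=
  hU.exists_lift (CommAlgCat.of k k) _ (hF.one_mem _)

theorem IsUniversal.exists_antipode (hU : IsUniversal F U) (hF : IsClosedUnderBoxConv F) :
    ∃ φ : A →ₐ[k] A, boxConv U (U.map φ) = oneSeries s A ∧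
      boxConv (U.map φ) U = oneSeries s A := by
  obtain ⟨g, hg, h1, h2⟩ := hF.exists_two_sided_inv hU.mem
  obtain ⟨φ, rfl⟩ := hU.exists_lift (CommAlgCat.of k A) g hg
  exact ⟨φ, h1, h2⟩

/-- The co-multiplication belonging to the boxed convolution. -/
def IsUniversal.comul (hU : IsUniversal F U) (hF : IsClosedUnderBoxConv F) :
    A →ₐ[k] A ⊗[k] A := (hU.exists_comul hF).choose

/-- The co-unit belonging to the unit series. -/
def IsUniversal.counit (hU : IsUniversal F U) (hF : IsClosedUnderBoxConv F) :
    A →ₐ[k] k := (hU.exists_counit hF).choose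

/-- The antipode belonging to the inversion. -/
def IsUniversal.antipode (hU : IsUniversal F U) (hF : IsClosedUnderBoxConv F) :
    A →ₐ[k] A := (hU.exists_antipode hF).choose

variable (hU : IsUniversal F U) (hF : IsClosedUnderBoxConv F)

theorem IsUniversal.map_comul : U.map (hU.comul hF) =
    boxConv (U.map (inl k A A))
      (U.map (inr k A A)) := (hU.exists_comul hF).choose_spec

/-- This is the Yoneda dictionary: composing with Δ corresponds to multiplying the series classified
by the two restrictions. With `hom_ext` it turns Hopf axioms into identities between series. -/
theorem IsUniversal.map_comp_comul {R : Type u} [CommRing R] [Algebra k R]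
    (Φ : A ⊗[k] A →ₐ[k] R) : U.map (Φ.comp (hU.comul hF)) =
      boxConv (U.map (Φ.comp (inl k A A)))
        (U.map (Φ.comp (inr k A A))) := by
  rw [← PSeries.map_map, hU.map_comul hF, PSeries.map_boxConv, PSeries.map_map, PSeries.map_map]

theorem IsUniversal.map_counit : U.map (hU.counit hF) = oneSeries s k :=
  (hU.exists_counit hF).choose_spec

theorem IsUniversal.map_comp_counit {R : Type u} [CommRing R] [Algebra k R] (Φ : k →ₐ[k] R) :
    U.map (Φ.comp (hU.counit hF)) = oneSeries s R := by
  rw [← PSeries.map_map, hU.map_counit hF, oneSeries_map]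

theorem IsUniversal.boxConv_antipode : boxConv U (U.map (hU.antipode hF)) = oneSeries s A :=
  (hU.exists_antipode hF).choose_spec.1

theorem IsUniversal.antipode_boxConv : boxConv (U.map (hU.antipode hF)) U = oneSeries s A :=
  (hU.exists_antipode hF).choose_spec.2

/-- The antipode axioms are stated for linear maps; for an S that is an algebra homomorphism the
composite is one too, since A is commutative, and universality applies. -/
theorem mul'_comp_rTensor (S : A →ₐ[k] A) (Δ : A →ₐ[k] A ⊗[k] A) :
    LinearMap.mul' k A ∘ₗ S.toLinearMap.rTensor A ∘ₗ Δ.toLinearMap =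
      (((Algebra.TensorProduct.lmul' k).comp (Algebra.TensorProduct.map S (.id k A))).comp
        Δ).toLinearMap := by
  have : LinearMap.mul' k A ∘ₗ S.toLinearMap.rTensor A = ((Algebra.TensorProduct.lmul' k).comp
      (Algebra.TensorProduct.map S (.id k A))).toLinearMap :=
    TensorProduct.ext' fun a b => by simp
  rw [← LinearMap.comp_assoc, this]
  rfl

theorem mul'_comp_lTensor (S : A →ₐ[k] A) (Δ : A →ₐ[k] A ⊗[k] A) :
    LinearMap.mul' k A ∘ₗ S.toLinearMap.lTensor A ∘ₗ Δ.toLinearMap =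
      (((Algebra.TensorProduct.lmul' k).comp (Algebra.TensorProduct.map (.id k A) S)).comp
        Δ).toLinearMap := by
  have : LinearMap.mul' k A ∘ₗ S.toLinearMap.lTensor A = ((Algebra.TensorProduct.lmul' k).comp
      (Algebra.TensorProduct.map (.id k A) S)).toLinearMap :=
    TensorProduct.ext' fun a b => by simp
  rw [← LinearMap.comp_assoc, this]
  rfl

/-- The Hopf algebra structure on the coordinate algebra of a closed subfunctor. -/
def IsUniversal.hopfStr : HopfStr k A where
  comul := hU.comul hF
  counit := hU.counit hF
  antipode := (hU.antipode hF).toLinearMap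
  coassoc := by
    apply hU.hom_ext
    -- Both sides classify the product of the three copies of U in A ⊗ (A ⊗ A), bracketed in two
    -- ways. The equations up to `h3` identify these copies, and `boxConv_assoc` concludes.
    let α := (Algebra.TensorProduct.assoc k k k A A A).toAlgHom
    have hl : (α.comp (Algebra.TensorProduct.map (hU.comul hF) (.id k A))).comp (inl k A A) =
        (α.comp (inl k (A ⊗[k] A) A)).comp (hU.comul hF) := AlgHom.ext fun a => by simp
    have hr : (Algebra.TensorProduct.map (.id k A) (hU.comul hF)).comp (inr k A A) =
        (inr k A (A ⊗[k] A)).comp (hU.comul hF) := AlgHom.ext fun a => by simp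
    have h1 : (α.comp (inl k (A ⊗[k] A) A)).comp (inl k A A) =
        (Algebra.TensorProduct.map (.id k A) (hU.comul hF)).comp (inl k A A) :=
      AlgHom.ext fun a => by simp [α, Algebra.TensorProduct.one_def]
    have h2 : (α.comp (inl k (A ⊗[k] A) A)).comp (inr k A A) =
        (inr k A (A ⊗[k] A)).comp (inl k A A) := AlgHom.ext fun a => by simp [α]
    have h3 : (α.comp (Algebra.TensorProduct.map (hU.comul hF) (.id k A))).comp (inr k A A) =
        (inr k A (A ⊗[k] A)).comp (inr k A A) :=
      AlgHom.ext fun a => by simp [α, Algebra.TensorProduct.one_def]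
    change U.map ((α.comp (Algebra.TensorProduct.map (hU.comul hF) (.id k A))).comp
      (hU.comul hF)) = _
    rw [hU.map_comp_comul hF, hU.map_comp_comul hF, hl, hr,
      hU.map_comp_comul hF, hU.map_comp_comul hF, boxConv_assoc, h1, h2, h3]
  rTensor_counit := by
    apply hU.hom_ext
    have hl : (Algebra.TensorProduct.map (hU.counit hF) (.id k A)).comp (inl k A A) =
        (inl k k A).comp (hU.counit hF) := by
      ext a; simp
    rw [hU.map_comp_comul hF, hl, hU.map_comp_counit hF, one_boxConv]
    congr 1
    ext a; simp
  lTensor_counit := by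
    apply hU.hom_ext
    have hl : (Algebra.TensorProduct.map (.id k A) (hU.counit hF)).comp (inr k A A) =
        (inr k A k).comp (hU.counit hF) := by
      ext a; simp
    rw [hU.map_comp_comul hF, hl, hU.map_comp_counit hF, boxConv_one]
    congr 1
    ext a; simp
  mul_antipode_rTensor := by
    rw [mul'_comp_rTensor]
    refine congrArg AlgHom.toLinearMap (a₂ := (Algebra.ofId k A).comp (hU.counit hF))
      (hU.hom_ext ?_)
    rw [hU.map_comp_comul hF, hU.map_comp_counit hF, ← hU.antipode_boxConv hF]
    congr 2
    · ext a; simp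
    · change _ = U.map (.id k A)
      congr 1
      ext a; simp
  mul_antipode_lTensor := by
    rw [mul'_comp_lTensor]
    refine congrArg AlgHom.toLinearMap (a₂ := (Algebra.ofId k A).comp (hU.counit hF))
      (hU.hom_ext ?_)
    rw [hU.map_comp_comul hF, hU.map_comp_counit hF, ← hU.boxConv_antipode hF]
    congr 2
    · change _ = U.map (.id k A)
      congr 1
      ext a; simp
    · ext a; simp

/-- The representation of the functor by its coordinate algebra. -/
def IsUniversal.corepresentableBy (hU : IsUniversal F U) :
    F.toFunctor.CorepresentableBy (CommAlgCat.of k A) where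
  homEquiv {R} := Equiv.ofBijective
    (fun φ => (⟨U.map φ.hom, hU.map_mem φ.hom⟩ : F.toFunctor.obj R)) (by
      constructor
      · intro φ ψ h
        exact CommAlgCat.hom_ext (hU.hom_ext (congrArg Subtype.val h))
      · rintro ⟨f, hf⟩
        obtain ⟨φ, rfl⟩ := hU.exists_lift R f hf
        exact ⟨CommAlgCat.ofHom φ, rfl⟩)
  homEquiv_comp _ _ := rfl

theorem IsUniversal.map_conv {R : Type u} [CommRing R] [Algebra k R] (φ ψ : A →ₐ[k] R) :
    U.map ((hU.hopfStr hF).conv φ ψ) = boxConv (U.map φ) (U.map ψ) := by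
  refine (hU.map_comp_comul hF _).trans ?_
  rw [Algebra.TensorProduct.productMap_left, Algebra.TensorProduct.productMap_right]

theorem IsUniversal.represents : Represents (hU.hopfStr hF) hF.boxGroup U.coeff :=
  ⟨hU.corepresentableBy, fun _ _ _ φ ψ => ⟨fun _ => rfl,
    Subtype.ext (hU.map_conv hF φ ψ)⟩⟩

/-- The flipped Δ classifies the product of the two generic series in the other order, and any pair
f, g over R is a specialisation of the generic pair. -/
theorem IsUniversal.isCocomm_iff :
    (hU.hopfStr hF).IsCocomm ↔
      ∀ (R : CommAlgCat.{u} k) (f g : PSeries s R), f ∈ F.obj R → g ∈ F.obj R →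
        boxConv f g = boxConv g f := by
  let := (hU.hopfStr hF).toHopfAlgebra
  have hiff : (hU.hopfStr hF).IsCocomm ↔
      (Algebra.TensorProduct.comm k A A).toAlgHom.comp (hU.comul hF) = hU.comul hF := by
    constructor
    · rintro ⟨h⟩
      exact AlgHom.toLinearMap_injective h
    · intro h
      exact ⟨congrArg AlgHom.toLinearMap h⟩
  have hcomm : U.map ((Algebra.TensorProduct.comm k A A).toAlgHom.comp (hU.comul hF)) =
      boxConv (U.map (inr k A A))
        (U.map (inl k A A)) := by
    rw [hU.map_comp_comul hF]
    congr 2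
  rw [hiff]
  constructor
  · intro h R f g hf hg
    obtain ⟨φ, rfl⟩ := hU.exists_lift R f hf
    obtain ⟨ψ, rfl⟩ := hU.exists_lift R g hg
    rw [h, hU.map_comul hF] at hcomm
    have := congrArg (PSeries.map (Algebra.TensorProduct.productMap φ ψ)) hcomm
    simpa only [PSeries.map_boxConv, PSeries.map_map, Algebra.TensorProduct.productMap_left,
      Algebra.TensorProduct.productMap_right] using this
  · intro h
    apply hU.hom_ext
    rw [hcomm, hU.map_comul hF]
    exact h (CommAlgCat.of k (A ⊗[k] A)) _ _ (hU.map_mem _) (hU.map_mem _)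

end Universal

/-! ### Filtrations of algebras and of tensor squares -/

section Filtration

variable {k : Type u} [CommRing k] {A : Type u} [CommRing A] [Algebra k A]

/-- An ascending multiplicative filtration by submodules. -/
structure IsMulFiltration (W : ℕ → Submodule k A) : Prop where
  mono : Monotone W
  one_mem : 1 ∈ W 0
  mul_mem : ∀ m n, ∀ a ∈ W m, ∀ b ∈ W n, a * b ∈ W (m + n)

theorem IsMulFiltration.prod_mem {W : ℕ → Submodule k A} (hW : IsMulFiltration W) {ι : Type*}
    (t : Finset ι) (a : ι → A) (d : ι → ℕ) (h : ∀ i ∈ t, a i ∈ W (d i)) :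
    ∏ i ∈ t, a i ∈ W (∑ i ∈ t, d i) := by
  classical
  induction t using Finset.induction_on with
  | empty => simpa using hW.one_mem
  | insert i t hi ih =>
    rw [Finset.prod_insert hi, Finset.sum_insert hi]
    exact hW.mul_mem _ _ _ (h i (Finset.mem_insert_self i t)) _
      (ih fun j hj => h j (Finset.mem_insert_of_mem hj))

theorem IsMulFiltration.pow_mem {W : ℕ → Submodule k A} (hW : IsMulFiltration W) {a : A} {d : ℕ}
    (h : a ∈ W d) (c : ℕ) : a ^ c ∈ W (c * d) := by
  have := hW.prod_mem (Finset.range c) (fun _ => a) (fun _ => d) fun _ _ => h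
  simpa using this

/-- The induced filtration of the tensor square. -/
def tensorFiltration (W : ℕ → Submodule k A) (n : ℕ) : Submodule k (A ⊗[k] A) :=
  ⨆ j ∈ Finset.range (n + 1), Submodule.map₂ (TensorProduct.mk k A A) (W j) (W (n - j))

theorem tensorFiltration_le {W : ℕ → Submodule k A} {n : ℕ} {S : Submodule k (A ⊗[k] A)}
    (h : ∀ i j, i + j = n → ∀ a ∈ W i, ∀ b ∈ W j, a ⊗ₜ[k] b ∈ S) : tensorFiltration W n ≤ S := by
  refine iSup₂_le fun j hj => Submodule.map₂_le.2 fun a ha b hb => ?_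
  have := Finset.mem_range.1 hj
  exact h j (n - j) (by omega) a ha b hb

theorem tmul_mem_tensorFiltration {W : ℕ → Submodule k A} (hW : Monotone W) {i j n : ℕ}
    (hij : i + j ≤ n) {a b : A} (ha : a ∈ W i) (hb : b ∈ W j) :
    a ⊗ₜ[k] b ∈ tensorFiltration W n := by
  have hle : Submodule.map₂ (TensorProduct.mk k A A) (W i) (W (n - i)) ≤ tensorFiltration W n :=
    le_iSup₂ (f := fun j (_ : j ∈ Finset.range (n + 1)) =>
      Submodule.map₂ (TensorProduct.mk k A A) (W j) (W (n - j))) i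
      (Finset.mem_range.2 (by omega))
  exact hle (Submodule.apply_mem_map₂ _ ha (hW (by omega) hb))

theorem tensorFiltration_mono {W : ℕ → Submodule k A} (hW : Monotone W) :
    Monotone (tensorFiltration W) := by
  intro m n hmn
  apply tensorFiltration_le
  intro i j hij a ha b hb
  exact tmul_mem_tensorFiltration hW (hij.trans_le hmn) ha hb

theorem one_mem_tensorFiltration {W : ℕ → Submodule k A} (hW : IsMulFiltration W) :
    1 ∈ tensorFiltration W 0 := by
  rw [Algebra.TensorProduct.one_def]
  exact tmul_mem_tensorFiltration hW.mono (i := 0) (j := 0) le_rfl hW.one_mem hW.one_mem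

theorem tmul_mul_mem_tensorFiltration {W : ℕ → Submodule k A} (hW : IsMulFiltration W)
    {i j m n : ℕ} (hij : i + j = m) {a b : A} (ha : a ∈ W i) (hb : b ∈ W j)
    {y : A ⊗[k] A} (hy : y ∈ tensorFiltration W n) :
    a ⊗ₜ[k] b * y ∈ tensorFiltration W (m + n) := by
  have h : tensorFiltration W n ≤
      (tensorFiltration W (m + n)).comap (LinearMap.mulLeft k (a ⊗ₜ[k] b)) := by
    apply tensorFiltration_le
    intro i' j' hij' a' ha' b' hb'
    rw [Submodule.mem_comap, LinearMap.mulLeft_apply, Algebra.TensorProduct.tmul_mul_tmul]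
    exact tmul_mem_tensorFiltration hW.mono (by omega) (hW.mul_mem _ _ _ ha _ ha')
      (hW.mul_mem _ _ _ hb _ hb')
  have := Submodule.mem_comap.1 (h hy)
  rwa [LinearMap.mulLeft_apply] at this

theorem mul_mem_tensorFiltration {W : ℕ → Submodule k A} (hW : IsMulFiltration W) {m n : ℕ}
    {x y : A ⊗[k] A} (hx : x ∈ tensorFiltration W m) (hy : y ∈ tensorFiltration W n) :
    x * y ∈ tensorFiltration W (m + n) := by
  have h : tensorFiltration W m ≤
      (tensorFiltration W (m + n)).comap (LinearMap.mulRight k y) := by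
    apply tensorFiltration_le
    intro i j hij a ha b hb
    rw [Submodule.mem_comap, LinearMap.mulRight_apply]
    exact tmul_mul_mem_tensorFiltration hW hij ha hb hy
  have := Submodule.mem_comap.1 (h hx)
  rwa [LinearMap.mulRight_apply] at this

theorem isMulFiltration_tensorFiltration {W : ℕ → Submodule k A} (hW : IsMulFiltration W) :
    IsMulFiltration (tensorFiltration W) :=
  ⟨tensorFiltration_mono hW.mono, one_mem_tensorFiltration hW,
    fun _ _ _ hx _ hy => mul_mem_tensorFiltration hW hx hy⟩

variable {s : ℕ}

/-- The weights |U| - 1 of the blocks add up to the length of w minus the number of blocks. -/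
theorem blockProd_mem {W : ℕ → Submodule k A} (hW : IsMulFiltration W) {f : PSeries s A}
    {w : List (Fin s)} {P : Part w.length}
    (hf : ∀ U ∈ P.parts, f.coeff (restrict w U) ∈ W (U.card - 1)) :
    blockProd f w P ∈ W (w.length - P.parts.card) := by
  have h := hW.prod_mem P.parts _ _ hf
  have hsum : ∑ U ∈ P.parts, (U.card - 1) = w.length - P.parts.card := by
    rw [Finset.sum_tsub_distrib _ fun U hU => (P.nonempty_of_mem_parts hU).card_pos,
      P.sum_card_parts]
    simp
  rwa [hsum] at h

/-- The left side is the total weight of X_{w,π} ⊗ X_{w,K(π)}; this is why |w| - 1 is the right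
weight for X_w. -/
theorem sub_card_add_sub_card_le {n : ℕ} (hn : n ≠ 0) (π : Part n) :
    (n - π.parts.card) + (n - (kreweras π).parts.card) ≤ n - 1 := by
  have h1 := card_parts_add_card_parts_kreweras hn π
  have h2 := π.card_parts_le_card
  have h3 := (kreweras π).card_parts_le_card
  simp only [Finset.card_univ, Fintype.card_fin] at h2 h3
  omega

/-- The inverse of a series respects a filtration which the series respects. -/
theorem coeff_mem_of_boxConv_eq_one {W : ℕ → Submodule k A} (hW : IsMulFiltration W)
    {f g : PSeries s A} (hf : ∀ w, w ≠ [] → f.coeff w ∈ W (w.length - 1))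
    (c : Fin s → A) (hc : ∀ i, f.coeff [i] * c i = 1) (hcW : ∀ i, c i ∈ W 0)
    (h : boxConv f g = oneSeries s A) (w : List (Fin s)) (hw : w ≠ []) :
    g.coeff w ∈ W (w.length - 1) := by
  classical
  induction hn : w.length using Nat.strong_induction_on generalizing w with
  | _ n ih =>
    subst hn
    have h1 := congrArg (fun f => PSeries.coeff f w) h
    simp only [boxConv_coeff_eq_add _ _ hw] at h1
    -- The equation at w is solved for g_w. The prefactor has weight 0 and the sum involves g at
    -- shorter words only, so induction applies.
    have h2 : g.coeff w = (∏ i, c (w.get i)) * ((oneSeries s A).coeff w -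
        ∑ π : Part w.length with IsNonCrossing π ∧ π ≠ ⊥,
          blockProd f w π * blockProd g w (kreweras π)) := by
      rw [← h1, add_sub_cancel_right, ← mul_assoc, ← Finset.prod_mul_distrib,
        Finset.prod_eq_one fun i _ => by rw [mul_comm]; exact hc _, one_mul]
    rw [h2]
    have hprod : ∏ i, c (w.get i) ∈ W 0 := by
      simpa using hW.prod_mem Finset.univ (fun i => c (w.get i)) (fun _ => 0) fun i _ => hcW _
    rw [← Nat.zero_add (w.length - 1)]
    refine hW.mul_mem _ _ _ hprod _ (Submodule.sub_mem _ ?_ (Submodule.sum_mem _ fun π hπ => ?_))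
    · change (if w.length = 1 then (1 : A) else 0) ∈ _
      split_ifs
      · exact hW.mono (Nat.zero_le _) hW.one_mem
      · exact Submodule.zero_mem _
    · have hπ' := (Finset.mem_filter.1 hπ).2
      refine hW.mono (sub_card_add_sub_card_le (by simpa using hw) π)
        (hW.mul_mem _ _ _ (blockProd_mem hW fun U hU => ?_) _ (blockProd_mem hW fun U hU => ?_))
      · rw [← length_restrict w U]
        exact hf _ (restrict_ne_nil w (Finpartition.nonempty_of_mem_parts _ hU))
      · have hlt := card_lt_of_mem_kreweras hπ'.2 hU
        rw [← length_restrict w U] at hlt ⊢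
        exact ih _ hlt _ (restrict_ne_nil w (Finpartition.nonempty_of_mem_parts _ hU)) rfl

theorem IsUniversal.comul_mem {F : Subfunctor (seriesFunctor k s)} {U : PSeries s A}
    (hU : IsUniversal F U) (hF : IsClosedUnderBoxConv F) {W : ℕ → Submodule k A}
    (hW : IsMulFiltration W) (hUW : ∀ w, w ≠ [] → U.coeff w ∈ W (w.length - 1))
    (w : List (Fin s)) (hw : w ≠ []) :
    hU.comul hF (U.coeff w) ∈ tensorFiltration W (w.length - 1) := by
  classical
  have h := congrArg (fun f => PSeries.coeff f w) (hU.map_comul hF)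
  change hU.comul hF (U.coeff w) = (boxConv _ _).coeff w at h
  rw [h, boxConv_coeff _ _ hw]
  refine Submodule.sum_mem _ fun π _ => ?_
  rw [PSeries.blockProd_map, PSeries.blockProd_map, Algebra.TensorProduct.includeLeft_apply,
    Algebra.TensorProduct.includeRight_apply, Algebra.TensorProduct.tmul_mul_tmul, one_mul,
    mul_one]
  have hmem : ∀ P : Part w.length, blockProd U w P ∈ W (w.length - P.parts.card) := fun P =>
    blockProd_mem hW fun V hV => by
      rw [← length_restrict w V]
      exact hUW _ (restrict_ne_nil w (P.nonempty_of_mem_parts hV))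
  exact tmul_mem_tensorFiltration hW.mono (sub_card_add_sub_card_le (by simpa using hw) π)
    (hmem π) (hmem _)

end Filtration

/-- Group-like elements lie in the bottom of every filtration of a coalgebra over a field. -/
theorem HopfStr.IsGroupLike.mem_zero {k : Type u} [Field k] {A : Type u} [CommRing A]
    [Algebra k A] {H : HopfStr k A} {a : A} (ha : H.IsGroupLike a) {F : ℕ → Submodule k A}
    (hmono : Monotone F) (hex : ∀ a, ∃ n, a ∈ F n) (hF : H.ComulFiltered F) : a ∈ F 0 := by
  classical
  have hcomul : H.comul a = a ⊗ₜ[k] a := by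
    let := H.toHopfAlgebra
    exact IsGroupLikeElem.comul_eq_tmul_self (R := k) ha
  by_contra h0
  obtain ⟨n, hn⟩ : ∃ n, Nat.find (hex a) = n + 1 := by
    refine Nat.exists_eq_succ_of_ne_zero fun h => h0 ?_
    have := Nat.find_spec (hex a)
    rwa [h] at this
  have hmem : a ∈ F (n + 1) := hn ▸ Nat.find_spec (hex a)
  have hnot : a ∉ F n := Nat.find_min (hex a) (by omega)
  -- With n + 1 the least index of a step containing a, φ kills F n but not a. In each F_i ⊗ F_j
  -- with i + j = n + 1 one of the indices is at most n, so φ ⊗ φ kills Δ(a) = a ⊗ a, giving φ(a)² =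
  -- 0.
  obtain ⟨φ, hφa, hφ⟩ := Submodule.exists_le_ker_of_notMem hnot
  let Φ : A ⊗[k] A →ₗ[k] k := LinearMap.mul' k k ∘ₗ TensorProduct.map φ φ
  have hker : tensorFiltration F (n + 1) ≤ LinearMap.ker Φ := by
    refine tensorFiltration_le fun i j hij a ha b hb => ?_
    rw [LinearMap.mem_ker]
    change φ a * φ b = 0
    rcases Nat.lt_or_ge n i with hi | hi
    · have : φ b = 0 := hφ (hmono (by omega) hb)
      rw [this, mul_zero]
    · have : φ a = 0 := hφ (hmono hi ha)
      rw [this, zero_mul]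
  have h1 : φ a * φ a = 0 := by
    have h2 := hker (hF (n + 1) a hmem)
    rw [hcomul] at h2
    exact h2
  exact hφa (mul_self_eq_zero.1 h1)

/-! ### The weight filtration of polynomial algebras -/

section Weight

variable {k : Type u} [CommRing k] {s : ℕ} {B : Type u} [CommRing B] [Algebra k B]

/-- The weight of a monomial, where `X_w` has weight `|w| - 1`. -/
def monomialWeight (m : LongWord s →₀ ℕ) : ℕ := m.sum fun w c => c * (w.1.length - 1)

theorem monomialWeight_add (m m' : LongWord s →₀ ℕ) :
    monomialWeight (m + m') = monomialWeight m + monomialWeight m' :=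
  Finsupp.sum_add_index' (fun _ => Nat.zero_mul _) fun _ _ _ => Nat.add_mul _ _ _

theorem monomialWeight_zero : monomialWeight (0 : LongWord s →₀ ℕ) = 0 := Finsupp.sum_zero_index

theorem monomialWeight_single (w : LongWord s) :
    monomialWeight (Finsupp.single w 1) = w.1.length - 1 := by
  simp [monomialWeight]

/-- Every variable has positive weight because its word has length at least two. So the bottom step
consists of constants. -/
theorem eq_zero_of_monomialWeight_eq_zero {m : LongWord s →₀ ℕ} (h : monomialWeight m = 0) :
    m = 0 := by
  ext w
  by_contra hne
  have hw := w.2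
  have hpos : 0 < m w * (w.1.length - 1) :=
    Nat.mul_pos (Nat.pos_of_ne_zero hne) (by omega)
  exact hpos.ne' (Finset.sum_eq_zero_iff.1 h w (Finsupp.mem_support_iff.2 hne))

variable (k B s) in
/-- Polynomials of weight at most `j`. -/
def polyFiltration (j : ℕ) : Submodule k (MvPolynomial (LongWord s) B) where
  carrier := {p | ∀ m ∈ p.support, monomialWeight m ≤ j}
  zero_mem' := by simp
  add_mem' {p q} hp hq m hm := by
    classical
    rcases Finset.mem_union.1 (MvPolynomial.support_add hm) with h | h
    · exact hp m h
    · exact hq m h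
  smul_mem' c p hp m hm := by
    refine hp m ?_
    rw [MvPolynomial.mem_support_iff] at *
    intro h0
    rw [MvPolynomial.coeff_smul, h0, smul_zero] at hm
    exact hm rfl

theorem monomial_mem_polyFiltration {j : ℕ} {m : LongWord s →₀ ℕ} (h : monomialWeight m ≤ j)
    (b : B) : MvPolynomial.monomial m b ∈ polyFiltration k s B j := by
  intro m' hm'
  rw [Finset.mem_singleton.1 (MvPolynomial.support_monomial_subset hm')]
  exact h

theorem C_mem_polyFiltration (b : B) : MvPolynomial.C b ∈ polyFiltration k s B 0 :=
  monomial_mem_polyFiltration monomialWeight_zero.le b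

theorem X_mem_polyFiltration (w : LongWord s) :
    MvPolynomial.X w ∈ polyFiltration k s B (w.1.length - 1) :=
  monomial_mem_polyFiltration (monomialWeight_single w).le 1

variable (k B s) in
theorem isMulFiltration_polyFiltration : IsMulFiltration (polyFiltration k s B) where
  mono _ _ hij _ hp m hm := (hp m hm).trans hij
  one_mem := C_mem_polyFiltration 1
  mul_mem i j p hp q hq m hm := by
    classical
    obtain ⟨m₁, h₁, m₂, h₂, rfl⟩ := Finset.mem_add.1 (MvPolynomial.support_mul p q hm)
    rw [monomialWeight_add]
    exact Nat.add_le_add (hp _ h₁) (hq _ h₂)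

theorem exists_mem_polyFiltration (p : MvPolynomial (LongWord s) B) :
    ∃ n, p ∈ polyFiltration k s B n :=
  ⟨p.support.sup monomialWeight, fun _ hm => Finset.le_sup (f := monomialWeight) hm⟩

/-- A homomorphism respects filtrations if it does so on the generators. -/
theorem map_mem_of_generators {T : Type u} [CommRing T] [Algebra k T] {W : ℕ → Submodule k T}
    (hW : IsMulFiltration W) (φ : MvPolynomial (LongWord s) B →ₐ[k] T)
    (hC : ∀ b, φ (MvPolynomial.C b) ∈ W 0)
    (hX : ∀ w : LongWord s, φ (MvPolynomial.X w) ∈ W (w.1.length - 1)) {n : ℕ}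
    {p : MvPolynomial (LongWord s) B} (hp : p ∈ polyFiltration k s B n) : φ p ∈ W n := by
  rw [p.as_sum, map_sum]
  refine Submodule.sum_mem _ fun m hm => hW.mono (hp m hm) ?_
  rw [MvPolynomial.monomial_eq, map_mul, ← Nat.zero_add (monomialWeight m)]
  refine hW.mul_mem _ _ _ (hC _) _ ?_
  rw [Finsupp.prod, map_prod]
  refine hW.prod_mem _ _ _ fun w _ => ?_
  rw [map_pow]
  exact hW.pow_mem (hX w) _

end Weight

/-! ### Laurent polynomials -/

section Laurent

variable {k : Type u} [CommRing k] {s : ℕ}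

/-- The target need only be a monoid, since inverses in it are unique. It is applied to
multiplicative monoids of algebras, where it reduces claims on all Laurent monomials to the X_i. -/
theorem laurent_monoidHom_ext {M : Type*} [CommMonoid M] {p q : Multiplicative (Fin s → ℤ) →* M}
    (h : ∀ i, p (.ofAdd (Pi.single i 1)) = q (.ofAdd (Pi.single i 1))) : p = q := by
  have hadd : MonoidHom.toAdditiveRight p = MonoidHom.toAdditiveRight q :=
    AddMonoidHom.functions_ext _ _ _ fun i x => by
      have : (MonoidHom.toAdditiveRight p).comp (AddMonoidHom.single (fun _ : Fin s => ℤ) i) =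
          (MonoidHom.toAdditiveRight q).comp (AddMonoidHom.single (fun _ : Fin s => ℤ) i) :=
        AddMonoidHom.ext_int (h i)
      exact congrArg (fun f => f x) this
  exact MonoidHom.toAdditiveRight.injective hadd

theorem span_laurentMonomial :
    Submodule.span k (Set.range (laurentMonomial k (s := s))) = ⊤ := by
  rw [eq_top_iff]
  intro b _
  induction b using AddMonoidAlgebra.induction_linear with
  | zero => exact Submodule.zero_mem _
  | add f g hf hg => exact Submodule.add_mem _ (hf trivial) (hg trivial)
  | single e r =>
    have : AddMonoidAlgebra.single e r = r • laurentMonomial k e := by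
      simp [laurentMonomial]
    rw [this]
    exact Submodule.smul_mem _ _ (Submodule.subset_span ⟨e, rfl⟩)

theorem map_laurent_mem {M : Type*} [AddCommMonoid M] [Module k M] {S : Submodule k M}
    (φ : Laurent k s →ₗ[k] M) (h : ∀ e, φ (laurentMonomial k e) ∈ S) (b : Laurent k s) :
    φ b ∈ S := by
  have hle : Submodule.span k (Set.range (laurentMonomial k (s := s))) ≤ S.comap φ := by
    rw [Submodule.span_le]
    rintro _ ⟨e, rfl⟩
    exact h e
  rw [span_laurentMonomial] at hle
  exact hle (Submodule.mem_top (x := b))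

/-- Laurent monomials as a homomorphism of monoids. -/
def laurentOf (k : Type u) [CommRing k] (s : ℕ) : Multiplicative (Fin s → ℤ) →* Laurent k s :=
  AddMonoidAlgebra.of k (Fin s → ℤ)

/-- Substitution of units into Laurent polynomials. -/
def laurentHom {R : Type u} [CommRing R] [Algebra k R] (u : Fin s → Rˣ) : Laurent k s →ₐ[k] R :=
  AddMonoidAlgebra.lift k R (Fin s → ℤ)
    { toFun := fun e => ((∏ i, u i ^ (e.toAdd i) : Rˣ) : R)
      map_one' := by simp
      map_mul' := fun e e' => by simp [zpow_add, Finset.prod_mul_distrib] }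

theorem laurentHom_single {R : Type u} [CommRing R] [Algebra k R] (u : Fin s → Rˣ) (i : Fin s) :
    laurentHom u (laurentMonomial k (Pi.single i 1)) = (u i : R) := by
  have h : (∏ j, u j ^ (Pi.single i 1 : Fin s → ℤ) j : Rˣ) = u i := by
    rw [Finset.prod_eq_single i]
    · simp
    · intro j _ hj
      simp [Pi.single_eq_of_ne hj]
    · simp
  simp only [laurentHom, laurentMonomial, AddMonoidAlgebra.lift_single, one_smul]
  exact congrArg Units.val h

theorem laurent_algHom_ext {R : Type u} [CommRing R] [Algebra k R] {φ ψ : Laurent k s →ₐ[k] R}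
    (h : ∀ i, φ (laurentMonomial k (Pi.single i 1)) = ψ (laurentMonomial k (Pi.single i 1))) :
    φ = ψ := by
  have : (φ : Laurent k s →* R).comp (laurentOf k s) = (ψ : Laurent k s →* R).comp (laurentOf k s) :=
    laurent_monoidHom_ext h
  exact AddMonoidAlgebra.algHom_ext (fun e => congrArg (fun p => p (.ofAdd e)) this) (by ext)

theorem laurentMonomial_mul (e e' : Fin s → ℤ) :
    laurentMonomial k e * laurentMonomial k e' = laurentMonomial k (e + e') := by
  simp [laurentMonomial, AddMonoidAlgebra.single_mul_single]

theorem laurentMonomial_zero : laurentMonomial k (0 : Fin s → ℤ) = 1 := rfl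

end Laurent

/-! ### Universal series over algebras containing the Laurent polynomials -/

section LaurentUniversal

variable {k : Type u} [CommRing k] {s : ℕ} {A : Type u} [CommRing A] [Algebra k A]
  {F : Subfunctor (seriesFunctor k s)} {U : PSeries s A}

theorem IsUniversal.comul_coeff_singleton (hU : IsUniversal F U) (hF : IsClosedUnderBoxConv F)
    (i : Fin s) : hU.comul hF (U.coeff [i]) = U.coeff [i] ⊗ₜ[k] U.coeff [i] := by
  have h := congrArg (fun f => PSeries.coeff f [i]) (hU.map_comul hF)
  simp only [boxConv_coeff_singleton] at h
  refine h.trans ?_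
  change (U.coeff [i] ⊗ₜ[k] 1) * (1 ⊗ₜ[k] U.coeff [i]) = _
  rw [Algebra.TensorProduct.tmul_mul_tmul, one_mul, mul_one]

theorem IsUniversal.counit_coeff_singleton (hU : IsUniversal F U) (hF : IsClosedUnderBoxConv F)
    (i : Fin s) : hU.counit hF (U.coeff [i]) = 1 :=
  congrArg (fun f => PSeries.coeff f [i]) (hU.map_counit hF)

theorem IsUniversal.mul_antipode_coeff_singleton (hU : IsUniversal F U)
    (hF : IsClosedUnderBoxConv F) (i : Fin s) :
    U.coeff [i] * hU.antipode hF (U.coeff [i]) = 1 := by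
  have h := congrArg (fun f => PSeries.coeff f [i]) (hU.boxConv_antipode hF)
  simp only [boxConv_coeff_singleton] at h
  exact h

/-- Both e ↦ Δ(X^e) and e ↦ X^e ⊗ X^e are multiplicative and they agree at the X_i. The map j is the
inclusion for 𝔊ˢ and the identity for (𝔊ˢ)₁. -/
theorem IsUniversal.isGroupLike_laurentMonomial (hU : IsUniversal F U)
    (hF : IsClosedUnderBoxConv F) (j : Laurent k s →ₐ[k] A)
    (hj : ∀ i, U.coeff [i] = j (laurentMonomial k (Pi.single i 1))) (e : Fin s → ℤ) :
    (hU.hopfStr hF).IsGroupLike (j (laurentMonomial k e)) := by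
  let J : Multiplicative (Fin s → ℤ) →* A := (j : Laurent k s →* A).comp (laurentOf k s)
  have hcounit : (hU.counit hF : A →* k).comp J = 1 :=
    laurent_monoidHom_ext fun i => by
      change hU.counit hF (j (laurentMonomial k (Pi.single i 1))) = 1
      rw [← hj, hU.counit_coeff_singleton hF]
  have hcomul : (hU.comul hF : A →* A ⊗[k] A).comp J =
      (inl k A A : A →* A ⊗[k] A).comp J * (inr k A A : A →* A ⊗[k] A).comp J :=
    laurent_monoidHom_ext fun i => by
      change hU.comul hF (j (laurentMonomial k (Pi.single i 1))) =
        (j (laurentMonomial k (Pi.single i 1)) ⊗ₜ[k] 1) *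
          (1 ⊗ₜ[k] j (laurentMonomial k (Pi.single i 1)))
      rw [← hj, hU.comul_coeff_singleton hF, Algebra.TensorProduct.tmul_mul_tmul, one_mul,
        mul_one]
  let := (hU.hopfStr hF).toHopfAlgebra
  refine IsGroupLikeElem.mk (congrArg (fun p => p (.ofAdd e)) hcounit) ?_
  refine (congrArg (fun p => p (.ofAdd e)) hcomul).trans ?_
  change (j (laurentMonomial k e) ⊗ₜ[k] 1) * (1 ⊗ₜ[k] j (laurentMonomial k e)) = _
  rw [Algebra.TensorProduct.tmul_mul_tmul, one_mul, mul_one]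

theorem IsUniversal.antipode_laurentMonomial (hU : IsUniversal F U)
    (hF : IsClosedUnderBoxConv F) (j : Laurent k s →ₐ[k] A)
    (hj : ∀ i, U.coeff [i] = j (laurentMonomial k (Pi.single i 1))) (e : Fin s → ℤ) :
    hU.antipode hF (j (laurentMonomial k e)) = j (laurentMonomial k (-e)) := by
  let J : Multiplicative (Fin s → ℤ) →* A := (j : Laurent k s →* A).comp (laurentOf k s)
  have h : (hU.antipode hF : A →* A).comp J = J.comp invMonoidHom :=
    laurent_monoidHom_ext fun i => by
      change hU.antipode hF (j (laurentMonomial k (Pi.single i 1))) =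
        j (laurentMonomial k (-Pi.single i 1))
      have h1 := hU.mul_antipode_coeff_singleton hF i
      rw [hj] at h1
      have h2 : j (laurentMonomial k (-Pi.single i 1)) * j (laurentMonomial k (Pi.single i 1)) =
          1 := by
        rw [← map_mul, laurentMonomial_mul, neg_add_cancel, laurentMonomial_zero, map_one]
      rw [← one_mul (hU.antipode hF _), ← h2, mul_assoc, h1, mul_one]
  exact congrArg (fun p => p (.ofAdd e)) h

end LaurentUniversal

/-! ### The three functors are closed under the group operations -/

section Closed

variable (k : Type u) [CommRing k] (s : ℕ)

theorem oneSeries_coeff_singleton {R : Type u} [CommRing R] {s : ℕ} (i : Fin s) :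
    (oneSeries s R).coeff [i] = 1 := rfl

theorem isClosed_G : IsClosedUnderBoxConv (G k s) where
  one_mem R i := (isUnit_one : IsUnit (1 : R))
  mul_mem R f g hf hg i := by
    rw [boxConv_coeff_singleton]
    exact (hf i).mul (hg i)
  exists_inv R f hf := by
    choose c hc using fun i => (hf i).exists_right_inv
    have h := boxConv_invSeries f c hc
    refine ⟨invSeries f c, fun i => ?_, h⟩
    have h1 := congrArg (fun f => PSeries.coeff f [i]) h
    simp only [boxConv_coeff_singleton, oneSeries_coeff_singleton] at h1
    exact IsUnit.of_mul_eq_one_right _ h1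

theorem isClosed_GPlus : IsClosedUnderBoxConv (GPlus k s) where
  one_mem R i := rfl
  mul_mem R f g hf hg i := by
    rw [boxConv_coeff_singleton, hf i, hg i, mul_one]
  exists_inv R f hf := by
    have h := boxConv_invSeries f (fun _ => 1) (fun i => by rw [hf i, mul_one])
    refine ⟨invSeries f fun _ => 1, fun i => ?_, h⟩
    have h1 := congrArg (fun f => PSeries.coeff f [i]) h
    simp only [boxConv_coeff_singleton, oneSeries_coeff_singleton] at h1
    rw [hf i, one_mul] at h1
    exact h1

/-- The series `∑ c_i z_i`. -/
def linearSeries {s : ℕ} {R : Type u} [CommRing R] (c : Fin s → R) : PSeries s R :=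
  ⟨fun | [i] => c i | _ => 0, rfl⟩

theorem linearSeries_coeff_eq_zero {s : ℕ} {R : Type u} [CommRing R] (c : Fin s → R)
    {w : List (Fin s)} (hw : 1 < w.length) : (linearSeries c).coeff w = 0 := by
  match w, hw with
  | _ :: _ :: _, _ => rfl

theorem eq_singleton_or_one_lt {s : ℕ} {w : List (Fin s)} (hw : w ≠ []) :
    (∃ i, w = [i]) ∨ 1 < w.length := by
  match w, hw with
  | [i], _ => exact Or.inl ⟨i, rfl⟩
  | _ :: _ :: _, _ => exact Or.inr (by simp)

theorem isClosed_G₁ : IsClosedUnderBoxConv (G₁ k s) where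
  one_mem R := ⟨fun _ => (isUnit_one : IsUnit (1 : R)), fun _ hw => if_neg hw.ne'⟩
  mul_mem R f g hf hg := ⟨(isClosed_G k s).mul_mem R f g hf.1 hg.1,
    fun _ hw => boxConv_coeff_eq_zero hf.2 hg.2 hw⟩
  exists_inv R f hf := by
    choose c hc using fun i => (hf.1 i).exists_right_inv
    -- On series without higher terms ⊠ is coefficientwise multiplication, so the inverse is linear
    -- too.
    refine ⟨linearSeries c, ⟨fun i => IsUnit.of_mul_eq_one_right _ (hc i),
      fun w hw => linearSeries_coeff_eq_zero c hw⟩, ?_⟩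
    apply pseries_ext
    intro w hw
    rcases eq_singleton_or_one_lt hw with ⟨i, rfl⟩ | hw
    · rw [boxConv_coeff_singleton]
      exact hc i
    · rw [boxConv_coeff_eq_zero hf.2 (fun _ hu => linearSeries_coeff_eq_zero c hu) hw]
      exact (if_neg hw.ne').symm

end Closed

/-! ### The universal series -/

section Coordinates

variable (k : Type u) [CommRing k] (s : ℕ)

/-- The universal element of `𝔊ˢ`. -/
def universalG : PSeries s (CoordG k s) := ⟨coordG k s, rfl⟩

/-- The universal element of `(𝔊ˢ)₁`. -/
def universalG₁ : PSeries s (Laurent k s) := ⟨coordG₁ k s, rfl⟩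

/-- The universal element of `𝔊ˢ₊`. -/
def universalGPlus : PSeries s (CoordGPlus k s) := ⟨coordGPlus k s, rfl⟩

theorem isUnit_laurentMonomial {s : ℕ} (e : Fin s → ℤ) : IsUnit (laurentMonomial k e) :=
  IsUnit.of_mul_eq_one (laurentMonomial k (-e)) (by
    rw [laurentMonomial_mul, add_neg_cancel, laurentMonomial_zero])

/-- A homomorphism out of the coordinate algebra is a choice of a unit for each X_i and of an
arbitrary element for each X_w. -/
theorem isUniversal_G : IsUniversal (G k s) (universalG k s) where
  mem _ := (isUnit_laurentMonomial k _).map MvPolynomial.C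
  exists_lift R f hf := by
    choose u hu using hf
    refine ⟨MvPolynomial.aevalTower (laurentHom u) fun w => f.coeff w.1, ?_⟩
    apply pseries_ext
    intro w hw
    match w, hw with
    | [i], _ =>
      refine (MvPolynomial.aevalTower_C _ _ _).trans ?_
      rw [laurentHom_single, hu]
    | _ :: _ :: _, _ => exact MvPolynomial.aevalTower_X _ _ _
  hom_ext {R _ _ φ ψ} h := by
    apply MvPolynomial.algHom_ext'
    · exact laurent_algHom_ext fun i => congrArg (fun f => PSeries.coeff f [i]) h
    · rintro ⟨w, hw⟩
      match w, hw with
      | i :: j :: w, _ => exact congrArg (fun f => PSeries.coeff f (i :: j :: w)) h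

theorem isUniversal_G₁ : IsUniversal (G₁ k s) (universalG₁ k s) where
  mem := ⟨fun _ => isUnit_laurentMonomial k _, fun w hw => by
    match w, hw with
    | _ :: _ :: _, _ => rfl⟩
  exists_lift R f hf := by
    choose u hu using hf.1
    refine ⟨laurentHom u, ?_⟩
    apply pseries_ext
    intro w hw
    match w, hw with
    | [i], _ => exact (laurentHom_single u i).trans (hu i)
    | i :: j :: w, _ => exact (map_zero (laurentHom u)).trans (hf.2 (i :: j :: w) (by simp)).symm
  hom_ext {R _ _ φ ψ} h :=
    laurent_algHom_ext fun i => congrArg (fun f => PSeries.coeff f [i]) h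

theorem isUniversal_GPlus : IsUniversal (GPlus k s) (universalGPlus k s) where
  mem _ := rfl
  exists_lift R f hf := by
    refine ⟨MvPolynomial.aeval fun w => f.coeff w.1, ?_⟩
    apply pseries_ext
    intro w hw
    match w, hw with
    | [i], _ => exact (map_one _).trans (hf i).symm
    | _ :: _ :: _, _ => exact MvPolynomial.aeval_X _ _
  hom_ext {R _ _ φ ψ} h := by
    apply MvPolynomial.algHom_ext
    rintro ⟨w, hw⟩
    match w, hw with
    | i :: j :: w, _ => exact congrArg (fun f => PSeries.coeff f (i :: j :: w)) h

end Coordinates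

/-! ### The filtration of the coordinate algebra of `𝔊ˢ` -/

section CoordFiltration

variable (k : Type u) [CommRing k] (s : ℕ)

/-- The inclusion of the Laurent polynomials. -/
abbrev laurentIncl : Laurent k s →ₐ[k] CoordG k s :=
  IsScalarTower.toAlgHom k (Laurent k s) (CoordG k s)

/-- The description by supports, which treats Laurent coefficients as a whole, is easier to work
with than the span of monomials. -/
theorem weightFiltration_eq (n : ℕ) :
    weightFiltration k s n = polyFiltration k s (Laurent k s) n := by
  apply le_antisymm
  · refine Submodule.span_le.2 ?_
    rintro _ ⟨e, m, hm, rfl⟩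
    exact monomial_mem_polyFiltration hm _
  · intro p hp
    rw [p.as_sum]
    refine Submodule.sum_mem _ fun m hm => ?_
    refine map_laurent_mem ((MvPolynomial.monomial m : Laurent k s →ₗ[Laurent k s]
      CoordG k s).restrictScalars k) (fun e => ?_) _
    exact Submodule.subset_span ⟨e, m, hp m hm, rfl⟩

theorem universalG_mem (w : List (Fin s)) (hw : w ≠ []) :
    (universalG k s).coeff w ∈ polyFiltration k s (Laurent k s) (w.length - 1) := by
  match w, hw with
  | [i], _ => exact C_mem_polyFiltration _
  | i :: j :: w, _ => exact X_mem_polyFiltration ⟨i :: j :: w, by simp⟩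

theorem universalGPlus_mem (w : List (Fin s)) (hw : w ≠ []) :
    (universalGPlus k s).coeff w ∈ polyFiltration k s k (w.length - 1) := by
  match w, hw with
  | [i], _ => exact (isMulFiltration_polyFiltration k s k).one_mem
  | i :: j :: w, _ => exact X_mem_polyFiltration ⟨i :: j :: w, by simp⟩

theorem universalG_coeff_longWord (w : LongWord s) :
    (universalG k s).coeff w.1 = MvPolynomial.X w := by
  obtain ⟨w, hw⟩ := w
  match w, hw with
  | _ :: _ :: _, _ => rfl

theorem universalGPlus_coeff_longWord (w : LongWord s) :
    (universalGPlus k s).coeff w.1 = MvPolynomial.X w := by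
  obtain ⟨w, hw⟩ := w
  match w, hw with
  | _ :: _ :: _, _ => rfl

theorem LongWord.ne_nil {s : ℕ} (w : LongWord s) : w.1 ≠ [] := by
  have := w.2
  rintro h
  simp [h] at this

/-- The Hopf algebra of `𝔊ˢ`. -/
def hopfG : HopfStr k (CoordG k s) := (isUniversal_G k s).hopfStr (isClosed_G k s)

/-- The Hopf algebra of `(𝔊ˢ)₁`. -/
def hopfG₁ : HopfStr k (Laurent k s) := (isUniversal_G₁ k s).hopfStr (isClosed_G₁ k s)

/-- The Hopf algebra of `𝔊ˢ₊`. -/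
def hopfGPlus : HopfStr k (CoordGPlus k s) :=
  (isUniversal_GPlus k s).hopfStr (isClosed_GPlus k s)

theorem isGroupLike_C_laurentMonomial (e : Fin s → ℤ) :
    (hopfG k s).IsGroupLike (MvPolynomial.C (laurentMonomial k e)) :=
  (isUniversal_G k s).isGroupLike_laurentMonomial (isClosed_G k s) (laurentIncl k s)
    (fun _ => rfl) e

theorem isGroupLike_laurentMonomial (e : Fin s → ℤ) :
    (hopfG₁ k s).IsGroupLike (laurentMonomial k e) :=
  (isUniversal_G₁ k s).isGroupLike_laurentMonomial (isClosed_G₁ k s) (.id k _)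
    (fun _ => rfl) e

theorem comul_eq_of_isGroupLike {A : Type u} [CommRing A] [Algebra k A] {H : HopfStr k A} {a : A}
    (h : H.IsGroupLike a) : H.comul a = a ⊗ₜ[k] a := by
  let := H.toHopfAlgebra
  exact IsGroupLikeElem.comul_eq_tmul_self (R := k) h

theorem comul_mem_tensorFiltration_G {n : ℕ} {a : CoordG k s}
    (ha : a ∈ polyFiltration k s (Laurent k s) n) :
    (hopfG k s).comul a ∈ tensorFiltration (polyFiltration k s (Laurent k s)) n := by
  have hW := isMulFiltration_polyFiltration k s (Laurent k s)
  refine map_mem_of_generators (isMulFiltration_tensorFiltration hW) (hopfG k s).comul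
    (fun b => ?_) (fun w => ?_) ha
  · refine map_laurent_mem ((hopfG k s).comul.comp (laurentIncl k s)).toLinearMap
      (fun e => ?_) b
    change (hopfG k s).comul (MvPolynomial.C (laurentMonomial k e)) ∈ _
    rw [comul_eq_of_isGroupLike k (isGroupLike_C_laurentMonomial k s e)]
    exact tmul_mem_tensorFiltration hW.mono (i := 0) (j := 0) le_rfl (C_mem_polyFiltration _)
      (C_mem_polyFiltration _)
  · rw [← universalG_coeff_longWord]
    exact (isUniversal_G k s).comul_mem (isClosed_G k s) hW (universalG_mem k s) w.1 w.ne_nil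

theorem antipode_mem_G {n : ℕ} {a : CoordG k s} (ha : a ∈ polyFiltration k s (Laurent k s) n) :
    (hopfG k s).antipode a ∈ polyFiltration k s (Laurent k s) n := by
  have hW := isMulFiltration_polyFiltration k s (Laurent k s)
  have hS := (isUniversal_G k s).antipode_laurentMonomial (isClosed_G k s) (laurentIncl k s)
    (fun _ => rfl)
  refine map_mem_of_generators hW ((isUniversal_G k s).antipode (isClosed_G k s))
    (fun b => ?_) (fun w => ?_) ha
  · refine map_laurent_mem (((isUniversal_G k s).antipode (isClosed_G k s)).comp
      (laurentIncl k s)).toLinearMap (fun e => ?_) b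
    change (isUniversal_G k s).antipode (isClosed_G k s) (laurentIncl k s (laurentMonomial k e)) ∈ _
    rw [hS]
    exact C_mem_polyFiltration _
  · rw [← universalG_coeff_longWord]
    -- S(X_w) is the coefficient at w of the inverse of the universal series, and S(X_i) = X_i⁻¹ has
    -- weight 0.
    refine coeff_mem_of_boxConv_eq_one hW (universalG_mem k s)
      (fun i => (isUniversal_G k s).antipode (isClosed_G k s) ((universalG k s).coeff [i]))
      (fun i => (isUniversal_G k s).mul_antipode_coeff_singleton (isClosed_G k s) i) (fun i => ?_)
      ((isUniversal_G k s).boxConv_antipode (isClosed_G k s)) w.1 w.ne_nil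
    have := hS (Pi.single i 1)
    change (isUniversal_G k s).antipode (isClosed_G k s) ((universalG k s).coeff [i]) = _ at this
    rw [this]
    exact C_mem_polyFiltration _

theorem comulFiltered_GPlus : (hopfGPlus k s).ComulFiltered (polyFiltration k s k) := by
  intro n a ha
  have hW := isMulFiltration_polyFiltration k s k
  refine map_mem_of_generators (isMulFiltration_tensorFiltration hW) (hopfGPlus k s).comul
    (fun b => ?_) (fun w => ?_) ha
  · rw [MvPolynomial.algHom_C, Algebra.algebraMap_eq_smul_one]
    exact Submodule.smul_mem _ _ (one_mem_tensorFiltration hW)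
  · rw [← universalGPlus_coeff_longWord]
    exact (isUniversal_GPlus k s).comul_mem (isClosed_GPlus k s) hW (universalGPlus_mem k s) w.1
      w.ne_nil

theorem isFiltration_G : (hopfG k s).IsFiltration (weightFiltration k s) := by
  have hW := isMulFiltration_polyFiltration k s (Laurent k s)
  rw [funext (weightFiltration_eq k s)]
  exact
    { mono := hW.mono
      exhaustive := exists_mem_polyFiltration
      one_mem := hW.one_mem
      mul_mem := hW.mul_mem
      comul_mem := fun _ _ => comul_mem_tensorFiltration_G k s
      antipode_mem := fun _ _ => antipode_mem_G k s }

theorem eq_C_of_mem_polyFiltration_zero {B : Type u} [CommRing B] [Algebra k B]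
    {p : MvPolynomial (LongWord s) B} (hp : p ∈ polyFiltration k s B 0) :
    p = MvPolynomial.C (p.coeff 0) := by
  classical
  ext m
  rw [MvPolynomial.coeff_C]
  split_ifs with h
  · rw [h]
  · by_contra hne
    exact h (eq_zero_of_monomialWeight_eq_zero
      (Nat.le_zero.1 (hp m (MvPolynomial.mem_support_iff.2 hne)))).symm

theorem strictMono_weightFiltration [Nontrivial k] (hs : 1 ≤ s) :
    StrictMono (weightFiltration k s) := by
  rw [funext (weightFiltration_eq k s)]
  refine strictMono_nat_of_lt_succ fun n => lt_of_le_of_ne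
    ((isMulFiltration_polyFiltration k s (Laurent k s)).mono n.le_succ) fun h => ?_
  -- A word of length n + 2 has weight n + 1, so X_w lies in step n + 1 and not in step n.
  let w : LongWord s := ⟨List.replicate (n + 2) ⟨0, hs⟩, by simp⟩
  have hlen : w.1.length = n + 2 := List.length_replicate
  have hw : (MvPolynomial.X w : CoordG k s) ∈ polyFiltration k s (Laurent k s) (n + 1) := by
    have := X_mem_polyFiltration (k := k) (B := Laurent k s) w
    rwa [hlen] at this
  rw [← h] at hw
  have := hw (Finsupp.single w 1) (by simp [MvPolynomial.support_X])
  rw [monomialWeight_single, hlen] at this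
  omega

/-- Neither X_w nor 1 - X_w is a unit: they vanish under evaluation at 0 and at 1 respectively. -/
theorem not_isLocalRing_coordG [Nontrivial k] (hs : 1 ≤ s) : ¬ IsLocalRing (CoordG k s) := by
  intro h
  let w : LongWord s := ⟨[⟨0, hs⟩, ⟨0, hs⟩], le_rfl⟩
  rcases IsLocalRing.isUnit_or_isUnit_one_sub_self (MvPolynomial.X w : CoordG k s) with hu | hu
  · have := hu.map (MvPolynomial.eval fun _ => (0 : Laurent k s))
    simp at this
  · have := hu.map (MvPolynomial.eval fun _ => (1 : Laurent k s))
    simp at this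

theorem isCocomm_hopfGPlus_iff [Nontrivial k] (hs : 1 ≤ s) :
    (hopfGPlus k s).IsCocomm ↔ s = 1 := by
  rw [hopfGPlus, IsUniversal.isCocomm_iff]
  constructor
  · intro h
    by_contra hne
    let a : Fin s := ⟨0, hs⟩
    let b : Fin s := ⟨1, by omega⟩
    have hab : a ≠ b := by simp [a, b]
    have h1 := h (CommAlgCat.of k k) (pairSeries k a b) (pairSeries k b a)
      (pairSeries_coeff_singleton k a b) (pairSeries_coeff_singleton k b a)
    have h2 := congrArg (fun f => PSeries.coeff f [a, b, a]) h1
    exact one_ne_zero ((boxConv_pairSeries k hab).symm.trans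
      (h2.trans (boxConv_pairSeries_swap k hab)))
  · rintro rfl R f g _ _
    exact boxConv_comm f g

end CoordFiltration

/-! ### Group-like elements and co-connectedness over a field -/

section Field

variable (k : Type u) [Field k] (s : ℕ)

theorem weightFiltration_zero :
    weightFiltration k s 0 = Submodule.span k {a | (hopfG k s).IsGroupLike a} := by
  have hfil := isFiltration_G k s
  apply le_antisymm
  · intro p hp
    rw [weightFiltration_eq] at hp
    rw [eq_C_of_mem_polyFiltration_zero k s hp]
    exact map_laurent_mem (laurentIncl k s).toLinearMap
      (fun e => Submodule.subset_span (isGroupLike_C_laurentMonomial k s e)) _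
  · exact Submodule.span_le.2 fun a ha => HopfStr.IsGroupLike.mem_zero ha hfil.mono
      hfil.exhaustive hfil.comul_mem

/-- The group-like element X_1 would have to lie in the bottom step k, but it is not a scalar. -/
theorem not_isCoconnected_hopfG (hs : 1 ≤ s) : ¬ (hopfG k s).IsCoconnected := by
  rintro ⟨F, hmono, h0, hex, hF⟩
  let e : Fin s → ℤ := Pi.single ⟨0, hs⟩ 1
  have he : e ≠ 0 := by simp [e]
  have hmem := HopfStr.IsGroupLike.mem_zero (isGroupLike_C_laurentMonomial k s e) hmono hex hF
  rw [h0] at hmem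
  obtain ⟨c, hc⟩ := hmem
  have h1 : algebraMap k (Laurent k s) c = laurentMonomial k e :=
    MvPolynomial.C_injective (LongWord s) (Laurent k s) hc
  have h2 : (AddMonoidAlgebra.single 0 c : Laurent k s) = AddMonoidAlgebra.single e 1 := h1
  have h3 := congrArg (fun p => AddMonoidAlgebra.coeff p e) h2
  simp [he] at h3

theorem span_isGroupLike_hopfG₁ :
    Submodule.span k {a | (hopfG₁ k s).IsGroupLike a} = ⊤ := by
  rw [eq_top_iff, ← span_laurentMonomial]
  refine Submodule.span_mono ?_
  rintro _ ⟨e, rfl⟩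
  exact isGroupLike_laurentMonomial k s e

theorem isCoconnected_hopfGPlus : (hopfGPlus k s).IsCoconnected := by
  refine ⟨polyFiltration k s k, (isMulFiltration_polyFiltration k s k).mono, ?_,
    exists_mem_polyFiltration, comulFiltered_GPlus k s⟩
  apply le_antisymm
  · intro p hp
    exact ⟨p.coeff 0, (eq_C_of_mem_polyFiltration_zero k s hp).symm⟩
  · rintro _ ⟨c, rfl⟩
    exact C_mem_polyFiltration c

end Field

end BoxedConvolution
end

theorem mainTheorem5 (k : Type u) [Field k] (s : ℕ) (hs : 1 ≤ s) :
    (∃ (𝒢 : BoxGroup (G k s))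
        (H : HopfStr k (CoordG k s)),
      Represents H 𝒢 (coordG k s) ∧
      H.IsFiltration (weightFiltration k s) ∧
      StrictMono (weightFiltration k s) ∧
      weightFiltration k s 0 = Submodule.span k {a | H.IsGroupLike a} ∧
      ¬ H.IsCoconnected ∧
      ¬ IsLocalRing (CoordG k s)) ∧
    (∃ (𝒢₁ : BoxGroup (G₁ k s))
        (H₁ : HopfStr k (Laurent k s)),
      Represents H₁ 𝒢₁ (coordG₁ k s) ∧
      (∀ e : Fin s → ℤ, H₁.IsGroupLike (laurentMonomial k e)) ∧
      Submodule.span k {a | H₁.IsGroupLike a} = ⊤) ∧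
    (∃ (𝒢' : BoxGroup (GPlus k s))
        (H' : HopfStr k (CoordGPlus k s)),
      Represents H' 𝒢' (coordGPlus k s) ∧
      H'.IsCoconnected ∧
      (H'.IsCocomm ↔ s = 1)) :=
  ⟨⟨(isClosed_G k s).boxGroup, hopfG k s,
      (isUniversal_G k s).represents (isClosed_G k s), isFiltration_G k s,
      strictMono_weightFiltration k s hs, weightFiltration_zero k s,
      not_isCoconnected_hopfG k s hs, not_isLocalRing_coordG k s hs⟩,
    ⟨(isClosed_G₁ k s).boxGroup, hopfG₁ k s,
      (isUniversal_G₁ k s).represents (isClosed_G₁ k s), isGroupLike_laurentMonomial k s,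
      span_isGroupLike_hopfG₁ k s⟩,
    ⟨(isClosed_GPlus k s).boxGroup, hopfGPlus k s,
      (isUniversal_GPlus k s).represents (isClosed_GPlus k s), isCoconnected_hopfGPlus k s,
      isCocomm_hopfGPlus_iff k s hs⟩⟩
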